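/- **Theorem 3.1.** (a) If $\mathrm{SR}$ and $\mathrm{MA}_{\omega_1}(\mathrm{Cohen})$ hold, then $\omega_2$ has the super tree property. (b) If $\mathrm{SSR}$ and $\mathrm{MA}_{\omega_1}(\mathrm{Cohen})$ hold, then $\omega_2$ has the strong tree property. Here the following definitions are used. *Stationary sets.* For a regular uncountable cardinal $\kappa$ and a set $A$, $[A]^{<\kappa}$ is the set of all subsets of $A$ of size $<\kappa$, and $[A]^{\omega}$ is the set of all countably infinite subsets of $A$. A set $C\subseteq[A]^{<\kappa}$ is club if it is $\subseteq$-cofinal in $[A]^{<\kappa}$ and closed under unions of $\subseteq$-increasing sequences of nonzero length $<\kappa$. A set $S\subseteq[A]^{<\kappa}$ is stationary in $[A]^{<\kappa}$ if it meets every club subset of $[A]^{<\kappa}$. A set $S\subseteq[A]^{\omega}$ is stationary in $[A]^\omega$ if it is stationary in $[A]^{<\omega_1}$. *Reflection.* For an ordinal $\lambda\ge\omega_2$, a set $S\subseteq[\lambda]^\omega$ is full if $y\in S$ whenever $x\in S$, $y\in[\lambda]^\omega$, $x\subseteq y$ and $x\cap\omega_1=y\cap\omega_1$. $\mathrm{SR}$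 (respectively $\mathrm{SSR}$) says that for every ordinal $\lambda\ge\omega_2$ and every stationary (respectively, every full stationary) $S\subseteq[\lambda]^\omega$ there is $I\subseteq\lambda$ with $|I|=\omega_1$ and $\omega_1\subseteq I$ such that $S\cap[I]^\omega$ is stationary in $[I]^\omega$. *Martin's Axiom.* $\mathrm{MA}_{\omega_1}(\mathrm{Cohen})$ says that for every family of at most $\omega_1$ dense subsets of the Cohen poset (all finite partial functions from $\omega$ to $\{0,1\}$, ordered by reverse extension) there is a filter in the poset that meets all members of the family. *Trees.* Let $\kappa$ be a regular uncountable cardinal and $\lambda\ge\kappa$ an ordinal. A $(\kappa,\lambda)$-tree is a set $\mathscr F$ of partial functions of size $<\kappa$ from $\lambda$ to $\{0,1\}$ which is closed under restrictions and such that for every $u\in[\lambda]^{<\kappa}$ the level $\mathrm{lev}_u(\mathscr F)=\{f\in\mathscr F:\mathrm{dom}(f)=u\}$ is nonempty. It is thin if $|\mathrm{lev}_u(\mathscr F)|<\kappa$ for all $u\in[\lambda]^{<\kappa}$. A cofinal branch through $\mathscr F$ is a function $b:\lambda\to\{0,1\}$ with $b\restriction u\in\mathscr F$ for all $u\in[\lambda]^{<\kappa}$.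 A level sequence of $\mathscr F$ is a sequence $\vec f=(f_u:u\in[\lambda]^{<\kappa})$ with $f_u\in\mathrm{lev}_u(\mathscr F)$ for all $u$. A cofinal branch $b$ through $\mathscr F$ is ineffable for $\vec f$ if $\{u\in[\lambda]^{<\kappa}:b\restriction u=f_u\}$ is stationary in $[\lambda]^{<\kappa}$. The cardinal $\kappa$ has the strong tree property if for every ordinal $\lambda\ge\kappa$ every thin $(\kappa,\lambda)$-tree has a cofinal branch. It has the super tree property if for every ordinal $\lambda\ge\kappa$, every thin $(\kappa,\lambda)$-tree $\mathscr F$ and every level sequence $\vec f$ of $\mathscr F$, there is a cofinal branch through $\mathscr F$ that is ineffable for $\vec f$. -/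

import Mathlib

open Cardinal Ordinal

universe u v

/-- `[A]^{<κ}`: the set of all subsets of `A` of cardinality less than `κ`. -/
def smallSubsets {α : Type v} (κ : Cardinal.{v}) (A : Set α) : Set (Set α) :=
  {x | x ⊆ A ∧ #x < κ}

/-- `[A]^ω`: the set of all countably infinite subsets of `A`. -/
def omegaSubsets {α : Type v} (A : Set α) : Set (Set α) :=
  {x | x ⊆ A ∧ #x = ℵ₀}

/-- `C` is club in `[A]^{<κ}`: it is a `⊆`-cofinal subset of `[A]^{<κ}` and is closed under unions
of `⊆`-increasing sequences `(x ξ : ξ < η)` of (nonzero) length `η < κ`. -/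
structure IsClubIn {α : Type v} (κ : Cardinal.{v}) (A : Set α) (C : Set (Set α)) : Prop where
  subset : C ⊆ smallSubsets κ A
  cofinal : ∀ x ∈ smallSubsets κ A, ∃ y ∈ C, x ⊆ y
  union_mem : ∀ η : Ordinal.{v}, 0 < η → η < κ.ord → ∀ x : Set.Iio η → Set α,
    Monotone x → (∀ ξ, x ξ ∈ C) → (⋃ ξ, x ξ) ∈ C

/-- `S` is a stationary subset of `[A]^{<κ}`: it meets all club subsets of `[A]^{<κ}`. -/
def IsStationaryIn {α : Type v} (κ : Cardinal.{v}) (A : Set α) (S : Set (Set α)) : Prop :=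
  S ⊆ smallSubsets κ A ∧ ∀ C, IsClubIn κ A C → (S ∩ C).Nonempty

/-- `S` is a stationary subset of `[A]^ω`: a subset of `[A]^ω` which is stationary in
`[A]^{<ω₁}`. -/
def IsStationaryOmega {α : Type v} (A : Set α) (S : Set (Set α)) : Prop :=
  S ⊆ omegaSubsets A ∧ IsStationaryIn ℵ₁ A S

/-- `ω₁`, as a subset of an ordinal `l` (identified with the set of ordinals below `l`). -/
def omegaOneIn (l : Ordinal.{u}) : Set (Set.Iio l) :=
  {a | (a : Ordinal.{u}) < ω₁}

/-- `y` is an `ω₁`-extension of `x`, written `x ⊑ y`. -/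
def IsOmegaOneExtension {l : Ordinal.{u}} (x y : Set (Set.Iio l)) : Prop :=
  x ⊆ y ∧ x ∩ omegaOneIn l = y ∩ omegaOneIn l

/-- `S ⊆ [l]^ω` is full: it is closed under `ω₁`-extensions (in `[l]^ω`). -/
def IsFull {l : Ordinal.{u}} (S : Set (Set (Set.Iio l))) : Prop :=
  ∀ x ∈ S, ∀ y ∈ omegaSubsets (Set.univ : Set (Set.Iio l)), IsOmegaOneExtension x y → y ∈ S

/-- `S` reflects: there is `I ⊆ l` of cardinality `ω₁` with `ω₁ ⊆ I` such that `S ∩ [I]^ω` is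
stationary in `[I]^ω`. -/
def Reflects {l : Ordinal.{u}} (S : Set (Set (Set.Iio l))) : Prop :=
  ∃ I : Set (Set.Iio l), #I = ℵ₁ ∧ omegaOneIn l ⊆ I ∧ IsStationaryOmega I (S ∩ omegaSubsets I)

/-- The stationary reflection principle `SR`: for every ordinal `l ≥ ω₂`, every stationary subset
of `[l]^ω` reflects. -/
def SR : Prop :=
  ∀ l : Ordinal.{u}, ω_ 2 ≤ l → ∀ S : Set (Set (Set.Iio l)),
    IsStationaryOmega Set.univ S → Reflects S

/-- The semi-stationary reflection principle `SSR`: for every ordinal `l ≥ ω₂`, every full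
stationary subset of `[l]^ω` reflects. -/
def SSR : Prop :=
  ∀ l : Ordinal.{u}, ω_ 2 ≤ l → ∀ S : Set (Set (Set.Iio l)),
    IsStationaryOmega Set.univ S → IsFull S → Reflects S

/-- `D` is a dense subset of the forcing poset `P` (smaller conditions are stronger). -/
def IsDenseIn {P : Type v} [Preorder P] (D : Set P) : Prop :=
  ∀ p : P, ∃ q ∈ D, q ≤ p

/-- `MA_κ(P)`: for every family of at most `κ` dense subsets of `P` there is a filter in `P` which
meets all of them. -/
def MartinAxiomFor (κ : Cardinal.{v}) (P : Type v) [Preorder P] : Prop :=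
  ∀ 𝒟 : Set (Set P), #𝒟 ≤ κ → (∀ D ∈ 𝒟, IsDenseIn D) →
    ∃ G : Order.PFilter P, ∀ D ∈ 𝒟, ∃ p ∈ G, p ∈ D

/-- The Cohen poset: all finite partial functions from `ω` to `{0, 1}`. -/
def CohenPoset : Type :=
  {p : ℕ →. Bool // p.Dom.Finite}

/-- The Cohen poset is ordered by reverse extension: `p ≤ q` if and only if `p ⊇ q`. -/
instance : PartialOrder CohenPoset where
  le p q := ∀ n b, b ∈ q.1 n → b ∈ p.1 n
  le_refl _ _ _ h := h
  le_trans _ _ _ h₁ h₂ n b h := h₁ n b (h₂ n b h)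
  le_antisymm _ _ h₁ h₂ := Subtype.ext (PFun.ext fun n b => ⟨h₂ n b, h₁ n b⟩)

/-- `MA_{ω₁}(Cohen)`. -/
def MACohen : Prop :=
  MartinAxiomFor ℵ₁ CohenPoset

/-- `[l]^{<κ}` for an ordinal `l` (identified with the set of ordinals below `l`). -/
def smallSubsetsOrd (κ : Cardinal.{u}) (l : Ordinal.{u}) : Set (Set (Set.Iio l)) :=
  smallSubsets (Cardinal.lift.{u + 1} κ) Set.univ

/-- The `u`-level of `F`: all members of `F` with domain `u`. -/
def level {l : Ordinal.{u}} (F : Set (Set.Iio l →. Bool)) (u : Set (Set.Iio l)) :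
    Set (Set.Iio l →. Bool) :=
  {f | f ∈ F ∧ f.Dom = u}

/-- `F` is a `(κ, l)`-tree: a family of partial functions of size less than `κ` from `l` to
`{0, 1}` which is closed under restrictions and has no empty level. -/
structure IsTwoCardinalTree (κ : Cardinal.{u}) (l : Ordinal.{u})
    (F : Set (Set.Iio l →. Bool)) : Prop where
  dom_mem : ∀ f ∈ F, f.Dom ∈ smallSubsetsOrd κ l
  restrict_mem : ∀ f ∈ F, ∀ (u : Set (Set.Iio l)) (h : u ⊆ f.Dom), f.restrict h ∈ F
  level_nonempty : ∀ u ∈ smallSubsetsOrd κ l, (level F u).Nonempty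

/-- `F` is thin: all its levels have size less than `κ`. -/
def IsThin (κ : Cardinal.{u}) (l : Ordinal.{u}) (F : Set (Set.Iio l →. Bool)) : Prop :=
  ∀ u ∈ smallSubsetsOrd κ l, #(level F u) < Cardinal.lift.{u + 1} κ

/-- `b : l → {0, 1}` is a cofinal branch through `F`: all restrictions of `b` to members of
`[l]^{<κ}` belong to `F`. -/
def IsCofinalBranch (κ : Cardinal.{u}) {l : Ordinal.{u}} (F : Set (Set.Iio l →. Bool))
    (b : Set.Iio l → Bool) : Prop :=
  ∀ u ∈ smallSubsetsOrd κ l, PFun.res b u ∈ F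

/-- `(f u : u ∈ [l]^{<κ})` is a level sequence of `F`. (Values of `f` at other `u` are
irrelevant.) -/
def IsLevelSequence (κ : Cardinal.{u}) {l : Ordinal.{u}} (F : Set (Set.Iio l →. Bool))
    (f : Set (Set.Iio l) → (Set.Iio l →. Bool)) : Prop :=
  ∀ u ∈ smallSubsetsOrd κ l, f u ∈ level F u

/-- The branch `b` is ineffable for `f`: the set of all `u ∈ [l]^{<κ}` such that the restriction
of `b` to `u` is `f u` is stationary in `[l]^{<κ}`. -/
def IsIneffableFor (κ : Cardinal.{u}) {l : Ordinal.{u}}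
    (f : Set (Set.Iio l) → (Set.Iio l →. Bool)) (b : Set.Iio l → Bool) : Prop :=
  IsStationaryIn (Cardinal.lift.{u + 1} κ) Set.univ
    {u | u ∈ smallSubsetsOrd κ l ∧ PFun.res b u = f u}

/-- `TP(κ, l)`: every thin `(κ, l)`-tree has a cofinal branch. -/
def TP (κ : Cardinal.{u}) (l : Ordinal.{u}) : Prop :=
  ∀ F : Set (Set.Iio l →. Bool), IsTwoCardinalTree κ l F → IsThin κ l F →
    ∃ b, IsCofinalBranch κ F b

/-- `ITP(κ, l)`: for every thin `(κ, l)`-tree and every level sequence of it there is an ineffable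
branch. -/
def ITP (κ : Cardinal.{u}) (l : Ordinal.{u}) : Prop :=
  ∀ F : Set (Set.Iio l →. Bool), IsTwoCardinalTree κ l F → IsThin κ l F →
    ∀ f, IsLevelSequence κ F f → ∃ b, IsCofinalBranch κ F b ∧ IsIneffableFor κ f b

/-- The strong tree property of a regular uncountable cardinal `κ`. -/
def StrongTreeProperty (κ : Cardinal.{u}) : Prop :=
  ∀ l : Ordinal.{u}, κ.ord ≤ l → TP κ l

/-- The super tree property of a regular uncountable cardinal `κ`. -/
def SuperTreeProperty (κ : Cardinal.{u}) : Prop :=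
  ∀ l : Ordinal.{u}, κ.ord ≤ l → ITP κ l

/-! Code nodes of the tree as subsets of their domains, and enumerate every level in type `ω₁`. The
support of a countable `M ⊆ ω₁ ⊕ 𝒫(l)` is the union of its members of size at most `ω₁`. Such an `M`
is guessing if every node on its support whose restrictions to the small sets in `M` all have an
index in `M` is the trace of some `B ∈ M`. Under `MACohen` there are stationarily many guessing sets
(`exists_isGuessing`). Reflection then yields `J ⊇ ω₁` of size `ω₁` inside which they are still
stationary.

Let `V` be the support of `J` and `T` a node on `V`. Some guessing `M ⊆ J` is closed under the map
sending `u` to an index of `T ∩ u`, so some `B ∈ M` agrees with `T` on the support of `M`. As `M`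
also contains, for each of its non-branches, a small set where it leaves the tree, `B` is a cofinal
branch. This gives the strong tree property. `SSR` suffices because the indices depend only on the
trace on `ω₁`: the supersets of guessing sets with the same trace form a full family. For the super
tree property take for `T` the given node on `V`. Closing `M` under sets that separate `T` from the
candidates `B` gives `B ∩ V = T`. If no branch were ineffable, closure of `J` under functions
choosing members of witnessing clubs would put `V` into the club of `B`, a contradiction.

Guessing sets come from a game: the second player covers given small sets, and accepts given sets
`B` or shows that they have a trace with no index below `δ`, all without the generated hull
acquiring a new element of `ω₁` at or above `δ`. For some `δ` the first player has no winning
strategy (`exists_isGoodPosition`). The finite good positions inside a suitable countable set form a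
countable poset, and `M` is the union of the hulls along a generic sequence. There is one dense set
for each node `T` on the support: either some trace of `T` without an index below `δ` is put into
`M`, or `T` is a thread through countable families. The latter have only countably many branches
(`exists_countable_branches`), and a branch can never be refused in the game, so it can be put into
`M`. -/

/-- `M` contains `h e` for all finite `e ⊆ M`. -/
def IsClosedUnder {X : Type v} (h : Finset X → Set X) (M : Set X) : Prop :=
  ∀ e : Finset X, ↑e ⊆ M → h e ⊆ M

/-- The least superset of `A` that is closed under `h`. -/
def hull {X : Type v} (h : Finset X → Set X) (A : Set X) : Set X :=
  ⋂₀ {M | A ⊆ M ∧ IsClosedUnder h M}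

/-! ### Hulls under set-valued finitary operations. -/

section Hull

variable {X : Type v} {h : Finset X → Set X} {A B M : Set X}

theorem subset_hull : A ⊆ hull h A := fun _ hx _ hM => hM.1 hx

theorem isClosedUnder_hull : IsClosedUnder h (hull h A) := fun e he _ hx M hM =>
  hM.2 e (fun _ hy => he hy M hM) hx

theorem hull_subset (hA : A ⊆ M) (hM : IsClosedUnder h M) : hull h A ⊆ M :=
  fun _ hx => hx M ⟨hA, hM⟩

theorem hull_mono (hAB : A ⊆ B) : hull h A ⊆ hull h B :=
  hull_subset (hAB.trans subset_hull) isClosedUnder_hull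

theorem countable_finset_subset (hA : A.Countable) : {e : Finset X | ↑e ⊆ A}.Countable := by
  have := Set.countable_ofPred_finite_subset hA
  refine (this.preimage_of_injOn (f := fun e : Finset X => (e : Set X))
    Finset.coe_injective.injOn).mono ?_
  intro e he
  exact ⟨e.finite_toSet, he⟩

theorem IsClosedUnder.iUnion_of_directed {ι : Type*} [Nonempty ι] {x : ι → Set X}
    (hd : Directed (· ⊆ ·) x) (hx : ∀ i, IsClosedUnder h (x i)) :
    IsClosedUnder h (⋃ i, x i) := by
  classical
  intro e he
  obtain ⟨i, hi⟩ : ∃ i, ↑e ⊆ x i :=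
    Directed.exists_mem_subset_of_finset_subset_biUnion hd he
  exact (hx i e hi).trans (Set.subset_iUnion x i)

theorem countable_hull (hh : ∀ e, (h e).Countable) (hA : A.Countable) :
    (hull h A).Countable := by
  let s : ℕ → Set X := fun n => Nat.rec A (fun _ B => B ∪ ⋃ e ∈ {e : Finset X | ↑e ⊆ B}, h e) n
  have hs : ∀ n, s (n + 1) = s n ∪ ⋃ e ∈ {e : Finset X | ↑e ⊆ s n}, h e := fun _ => rfl
  have hmono : Monotone s := monotone_nat_of_le_succ fun n => by
    rw [hs]; exact Set.subset_union_left
  have hc : ∀ n, (s n).Countable := by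
    intro n
    induction n with
    | zero => exact hA
    | succ n ih =>
      rw [hs]
      exact ih.union ((countable_finset_subset ih).biUnion fun e _ => hh e)
  refine (Set.countable_iUnion hc).mono (hull_subset (Set.subset_iUnion s 0) ?_)
  intro e he
  obtain ⟨n, hn⟩ : ∃ n, ↑e ⊆ s n :=
    Directed.exists_mem_subset_of_finset_subset_biUnion hmono.directed_le he
  refine Set.Subset.trans ?_ (Set.subset_iUnion s (n + 1))
  rw [hs]
  exact Set.Subset.trans (Set.subset_biUnion_of_mem (u := fun e => h e) hn) Set.subset_union_right

theorem IsClosedUnder.mono {h' : Finset X → Set X} (hM : IsClosedUnder h' M)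
    (hle : ∀ e, h e ⊆ h' e) : IsClosedUnder h M := fun e he => (hle e).trans (hM e he)

end Hull

/-! ### Clubs in `[A]^{<κ}`: directed unions and closure functions. -/

section Club

variable {X : Type v} {κ : Cardinal.{v}} {A : Set X} {C : Set (Set X)}

theorem IsClubIn.iUnion_nat (hC : IsClubIn κ A C) (hκ : ℵ₀ < κ) {x : ℕ → Set X}
    (hx : Monotone x) (hxC : ∀ n, x n ∈ C) : (⋃ n, x n) ∈ C := by
  have hlt : ∀ ξ : Set.Iio (ω : Ordinal.{v}), ∃ n : ℕ, (n : Ordinal.{v}) = ξ := by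
    rintro ⟨ξ, hξ⟩
    obtain ⟨n, hn⟩ := Ordinal.lt_omega0.1 hξ
    exact ⟨n, hn.symm⟩
  choose f hf using hlt
  have key := hC.union_mem ω Ordinal.omega0_pos (by rw [Cardinal.lt_ord]; simpa using hκ)
    (fun ξ => x (f ξ)) ?_ fun ξ => hxC _
  · convert key using 1
    apply Set.Subset.antisymm
    · refine Set.iUnion_subset fun n => ?_
      have : f ⟨n, Ordinal.natCast_lt_omega0 n⟩ = n := by
        have := hf ⟨n, Ordinal.natCast_lt_omega0 n⟩
        exact Nat.cast_injective this
      refine Set.Subset.trans ?_ (Set.subset_iUnion _ ⟨n, Ordinal.natCast_lt_omega0 n⟩)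
      rw [this]
    · exact Set.iUnion_subset fun ξ => Set.subset_iUnion x _
  · intro ξ η h
    apply hx
    have h' : (ξ : Ordinal) ≤ η := h
    rw [← hf, ← hf] at h'
    exact_mod_cast h'

/-- A countable directed family has a cofinal increasing sequence, which reduces the claim to chains
of length `ω`. -/
theorem IsClubIn.iUnion_countable (hC : IsClubIn κ A C) (hκ : ℵ₀ < κ) {ι : Type*} [Countable ι]
    [Nonempty ι] {x : ι → Set X} (hx : Directed (· ⊆ ·) x) (hxC : ∀ i, x i ∈ C) :
    (⋃ i, x i) ∈ C := by
  classical
  have := Encodable.ofCountable ι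
  inhabit ι
  have key := hC.iUnion_nat hκ (x := fun n => x (hx.sequence x n))
    (hx.sequence_mono) fun n => hxC _
  convert key using 1
  apply Set.Subset.antisymm
  · exact Set.iUnion_subset fun i => (hx.rel_sequence i).trans (Set.subset_iUnion (fun n => x (hx.sequence x n)) _)
  · exact Set.iUnion_subset fun n => Set.subset_iUnion x _

/-- Every club in `[A]^{<ω₁}` contains all countable sets closed under a suitable function. -/
theorem IsClubIn.exists_closedUnder (hC : IsClubIn ℵ₁ A C) :
    ∃ h : Finset X → Set X, (∀ e, (h e).Countable) ∧ (∀ e, h e ⊆ A) ∧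
      ∀ M ⊆ A, M.Countable → IsClosedUnder h M → M ∈ C := by
  classical
  have hct : ∀ x ∈ C, x.Countable := fun x hx => by
    have := (hC.subset hx).2
    rw [← Cardinal.le_aleph0_iff_set_countable]
    rwa [← Order.lt_succ_iff, succ_aleph0]
  have hcof : ∀ x : Set X, x ⊆ A → x.Countable → ∃ y ∈ C, x ⊆ y := fun x hx hc =>
    hC.cofinal x ⟨hx, by rwa [← succ_aleph0, Order.lt_succ_iff, Cardinal.le_aleph0_iff_set_countable]⟩
  choose! c hcC hc using hcof
  -- a monotone assignment of members of `C` to finite sets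
  let H : ℕ → Finset X → Set X := fun n => Nat.rec (fun e => c (↑e ∩ A))
    (fun _ f e => c ((↑e ∩ A) ∪ ⋃ e' ∈ e.powerset, f e')) n
  have hH : ∀ n e, H n e ∈ C ∧ ↑e ∩ A ⊆ H n e := by
    intro n
    induction n with
    | zero =>
      intro e
      have := e.finite_toSet.inter_of_left A
      exact ⟨hcC _ Set.inter_subset_right this.countable, hc _ Set.inter_subset_right this.countable⟩
    | succ n ih =>
      intro e
      have h1 : (↑e ∩ A) ∪ ⋃ e' ∈ e.powerset, H n e' ⊆ A :=
        Set.union_subset Set.inter_subset_right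
          (Set.iUnion₂_subset fun e' _ => (hC.subset (ih e').1).1)
      have h2 : ((↑e ∩ A) ∪ ⋃ e' ∈ e.powerset, H n e').Countable :=
        ((e.finite_toSet.inter_of_left A).countable).union
          (e.powerset.countable_toSet.biUnion fun e' _ => hct _ (ih e').1)
      exact ⟨hcC _ h1 h2, Set.subset_union_left.trans (hc _ h1 h2)⟩
  have hHs : ∀ n e e', e' ⊆ e → H n e' ⊆ H (n + 1) e := by
    intro n e e' he
    have h1 : (↑e ∩ A) ∪ ⋃ e' ∈ e.powerset, H n e' ⊆ A :=
      Set.union_subset Set.inter_subset_right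
        (Set.iUnion₂_subset fun e' _ => (hC.subset (hH n e').1).1)
    have h2 : ((↑e ∩ A) ∪ ⋃ e' ∈ e.powerset, H n e').Countable :=
      ((e.finite_toSet.inter_of_left A).countable).union
        (e.powerset.countable_toSet.biUnion fun e' _ => hct _ (hH n e').1)
    refine Set.Subset.trans ?_ (hc _ h1 h2)
    refine Set.Subset.trans ?_ Set.subset_union_right
    exact Set.subset_biUnion_of_mem (u := fun e' => H n e') (Finset.mem_powerset.2 he)
  -- By `hHs` the limit is monotone in `e`. Hence a closed `M` is the union of the countable
  -- directed family of values at its finite subsets, each value being the union of an `ω`-chain in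
  -- `C`.
  refine ⟨fun e => ⋃ n, H n e, fun e => Set.countable_iUnion fun n => hct _ (hH n e).1,
    fun e => Set.iUnion_subset fun n => (hC.subset (hH n e).1).1, ?_⟩
  intro M hMA hMc hM
  have : Countable {e : Finset X | ↑e ⊆ M} := (countable_finset_subset hMc).to_subtype
  have : Nonempty {e : Finset X | ↑e ⊆ M} := ⟨⟨∅, by simp⟩⟩
  have hHm : ∀ e, Monotone fun n => H n e := fun e =>
    monotone_nat_of_le_succ fun n => hHs n e e subset_rfl
  have key := hC.iUnion_countable (by rw [← succ_aleph0]; exact Order.lt_succ _)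
    (x := fun p : {e : Finset X | ↑e ⊆ M} => ⋃ n, H n p) ?_ ?_
  · convert key using 1
    apply Set.Subset.antisymm
    · intro x hx
      refine Set.mem_iUnion.2 ⟨⟨{x}, by simpa using hx⟩, Set.mem_iUnion.2 ⟨0, (hH 0 _).2 ⟨by simp, hMA hx⟩⟩⟩
    · exact Set.iUnion_subset fun p => hM p.1 p.2
  · intro p q
    refine ⟨⟨p.1 ∪ q.1, by simpa using ⟨p.2, q.2⟩⟩, ?_, ?_⟩
    · exact Set.iUnion_subset fun n => (hHs n (p.1 ∪ q.1) p.1 Finset.subset_union_left).trans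
        (Set.subset_iUnion (fun n => H n (p.1 ∪ q.1)) (n + 1))
    · exact Set.iUnion_subset fun n => (hHs n (p.1 ∪ q.1) q.1 Finset.subset_union_right).trans
        (Set.subset_iUnion (fun n => H n (p.1 ∪ q.1)) (n + 1))
  · intro p
    exact hC.iUnion_nat (by rw [← succ_aleph0]; exact Order.lt_succ _) (hHm _) fun n => (hH n _).1

/-- The countable subsets of `A` closed under `h` (relativized to `A`) form a club. -/
theorem isClubIn_closedUnder {h : Finset X → Set X} (hh : ∀ e, (h e).Countable) :
    IsClubIn ℵ₁ A {M | M ⊆ A ∧ M.Countable ∧ IsClosedUnder (fun e => h e ∩ A) M} where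
  subset := fun M hM => ⟨hM.1, by
    rw [← succ_aleph0, Order.lt_succ_iff, Cardinal.le_aleph0_iff_set_countable]; exact hM.2.1⟩
  cofinal := fun x hx => by
    have hc : x.Countable := by
      rw [← Cardinal.le_aleph0_iff_set_countable, ← Order.lt_succ_iff, succ_aleph0]; exact hx.2
    exact ⟨hull (fun e => h e ∩ A) x, ⟨hull_subset hx.1 fun e _ => Set.inter_subset_right,
      countable_hull (fun e => (hh e).mono Set.inter_subset_left) hc, isClosedUnder_hull⟩,
      subset_hull⟩
  union_mem := fun η h0 hη x hx hxC => by
    have : Nonempty (Set.Iio η) := ⟨⟨0, h0⟩⟩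
    have hcard : Countable (Set.Iio η) := by
      rw [← Cardinal.mk_le_aleph0_iff, Cardinal.mk_Iio_ordinal, Cardinal.lift_le_aleph0,
        ← Order.lt_succ_iff, succ_aleph0]
      exact Cardinal.lt_ord.1 hη
    exact ⟨Set.iUnion_subset fun ξ => (hxC ξ).1, Set.countable_iUnion fun ξ => (hxC ξ).2.1,
      IsClosedUnder.iUnion_of_directed hx.directed_le fun ξ => (hxC ξ).2.2⟩

/-- A club in `[A]^{<ω₂}` is closed under directed unions of families of size at most `ω₁`. -/
theorem IsClubIn.sUnion_mem_of_directedOn (hC : IsClubIn (ℵ_ 2) A C) {𝒟 : Set (Set X)}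
    (h𝒟 : 𝒟 ⊆ C) (hne : 𝒟.Nonempty) (hd : DirectedOn (· ⊆ ·) 𝒟) (hcard : #𝒟 ≤ ℵ₁) :
    ⋃₀ 𝒟 ∈ C := by
  classical
  have hω : ℵ₀ < ℵ₁ := by rw [← succ_aleph0]; exact Order.lt_succ _
  have h12 : (ℵ₁ : Cardinal.{v}) < (ℵ_ 2) := aleph_lt_aleph.2 (by norm_num)
  obtain ⟨d₀, hd₀⟩ := hne
  obtain ⟨g⟩ : Nonempty (𝒟 ↪ Set.Iio (ω₁ : Ordinal.{v})) := by
    rw [← Cardinal.lift_mk_le', Cardinal.mk_Iio_ordinal, Ordinal.card_omega]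
    simpa using hcard
  have hub : ∀ e : Finset (Set X), ↑e ⊆ 𝒟 → ∃ d ∈ 𝒟, ∀ a ∈ e, a ⊆ d := by
    intro e
    induction e using Finset.induction_on with
    | empty => exact fun _ => ⟨d₀, hd₀, by simp⟩
    | insert a e _ ih =>
      intro he
      rw [Finset.coe_insert, Set.insert_subset_iff] at he
      obtain ⟨d, hd1, hd2⟩ := ih he.2
      obtain ⟨d', h1, h2, h3⟩ := hd a he.1 d hd1
      refine ⟨d', h1, fun b hb => ?_⟩
      rcases Finset.mem_insert.1 hb with rfl | hb
      · exact h2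
      · exact (hd2 b hb).trans h3
  choose! b hb𝒟 hb using hub
  let k : Finset (Set X) → Set (Set X) := fun e => {d | ↑e ⊆ 𝒟 ∧ d = b e}
  have hk : ∀ e, (k e).Countable := fun e =>
    (Set.countable_singleton (b e)).mono fun d hd => hd.2
  -- Initial pieces of `𝒟` along `g`. Their hulls under the upper-bound operation `b` are countable
  -- directed subfamilies, so their unions are members of `C` and form a chain of length `ω₁`.
  -- Adding `d₀` keeps each piece nonempty.
  let s : Set.Iio (ω₁ : Ordinal.{v}) → Set (Set X) := fun ξ =>
    insert d₀ {d | ∃ h : d ∈ 𝒟, (g ⟨d, h⟩ : Ordinal) < ξ}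
  have hs𝒟 : ∀ ξ, hull k (s ξ) ⊆ 𝒟 := fun ξ => hull_subset
    (Set.insert_subset hd₀ fun d hd => hd.1) fun e he d hd => hd.2 ▸ hb𝒟 e he
  have hsc : ∀ ξ, (hull k (s ξ)).Countable := fun ξ => by
    refine countable_hull hk (Set.Countable.insert _ ?_)
    have hξ : (Set.Iio (ξ : Ordinal.{v})).Countable := by
      rw [← Cardinal.le_aleph0_iff_set_countable, Cardinal.mk_Iio_ordinal, Cardinal.lift_le_aleph0,
        ← Order.lt_succ_iff, succ_aleph0]
      have := Cardinal.lt_ord.1 (lt_of_lt_of_eq ξ.2 (Cardinal.ord_aleph 1).symm)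
      exact this
    have : ({d : 𝒟 | (g d : Ordinal) < ξ}).Countable :=
      hξ.preimage_of_injOn (f := fun d => (g d : Ordinal))
        (fun a _ b _ h => g.injective (Subtype.ext h))
    refine (this.image Subtype.val).mono ?_
    rintro d ⟨h, h'⟩
    exact ⟨⟨d, h⟩, h', rfl⟩
  have key := hC.union_mem ω₁ (Ordinal.omega_pos 1) (by rw [← Cardinal.ord_aleph, Cardinal.ord_lt_ord]; exact h12)
    (fun ξ => ⋃₀ hull k (s ξ)) ?_ ?_
  · convert key using 1
    apply Set.Subset.antisymm
    · refine Set.sUnion_subset fun d hd => ?_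
      have hlim : Order.succ (g ⟨d, hd⟩ : Ordinal.{v}) < ω₁ :=
        (Cardinal.isSuccLimit_omega 1).succ_lt (g ⟨d, hd⟩).2
      refine Set.Subset.trans ?_ (Set.subset_iUnion _ ⟨_, hlim⟩)
      exact Set.subset_sUnion_of_mem (subset_hull (Or.inr ⟨hd, Order.lt_succ _⟩))
    · exact Set.iUnion_subset fun ξ => Set.sUnion_subset_sUnion (hs𝒟 ξ)
  · intro ξ η hle
    refine Set.sUnion_subset_sUnion (hull_mono (Set.insert_subset_insert ?_))
    rintro d ⟨h, h'⟩
    exact ⟨h, h'.trans_le hle⟩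
  · intro ξ
    have := (hsc ξ).to_subtype
    have : Nonempty (hull k (s ξ)) := ⟨⟨d₀, subset_hull (Or.inl rfl)⟩⟩
    rw [Set.sUnion_eq_iUnion]
    refine hC.iUnion_countable (hω.trans h12) ?_ fun d => h𝒟 (hs𝒟 ξ d.2)
    intro p q
    have he : ↑({p.1, q.1} : Finset (Set X)) ⊆ hull k (s ξ) := by
      simp only [Finset.coe_insert, Finset.coe_singleton]
      exact Set.insert_subset p.2 (Set.singleton_subset_iff.2 q.2)
    have he' := he.trans (hs𝒟 ξ)
    exact ⟨⟨b {p.1, q.1}, isClosedUnder_hull _ he ⟨he', rfl⟩⟩, hb _ he' _ (by simp),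
      hb _ he' _ (by simp)⟩

end Club

/-! ### Sets of size at most `ω₁`. -/

/-- The subsets of `α` of size at most `ω₁`. -/
def smallSets (α : Type v) : Set (Set α) := {u | #u ≤ ℵ₁}

section SmallSets

variable {α : Type v}

theorem mem_smallSets_of_countable {u : Set α} (hu : u.Countable) : u ∈ smallSets α :=
  (Cardinal.le_aleph0_iff_set_countable.2 hu).trans (aleph0_le_aleph 1)

theorem iUnion_mem_smallSets {ι : Type v} (hι : #ι ≤ ℵ₁) {f : ι → Set α}
    (hf : ∀ i, f i ∈ smallSets α) : (⋃ i, f i) ∈ smallSets α := by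
  calc #(⋃ i, f i) ≤ Cardinal.sum fun i => #(f i) := Cardinal.mk_iUnion_le_sum_mk
    _ ≤ Cardinal.sum fun _ : ι => (ℵ₁ : Cardinal.{v}) := Cardinal.sum_le_sum _ _ hf
    _ = #ι * ℵ₁ := by simp
    _ ≤ ℵ₁ * ℵ₁ := mul_le_mul_left hι _
    _ = ℵ₁ := Cardinal.mul_eq_self (aleph0_le_aleph 1)

theorem sUnion_mem_smallSets {𝒟 : Set (Set α)} (h𝒟 : #𝒟 ≤ ℵ₁) (hs : 𝒟 ⊆ smallSets α) :
    ⋃₀ 𝒟 ∈ smallSets α := by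
  rw [Set.sUnion_eq_iUnion]
  exact iUnion_mem_smallSets h𝒟 fun d => hs d.2

theorem union_mem_smallSets {u w : Set α} (hu : u ∈ smallSets α) (hw : w ∈ smallSets α) :
    u ∪ w ∈ smallSets α := by
  rw [← Set.sUnion_pair]
  refine sUnion_mem_smallSets ?_ (Set.insert_subset hu (Set.singleton_subset_iff.2 hw))
  exact ((Set.toFinite _).countable.le_aleph0).trans (aleph0_le_aleph 1)

end SmallSets

/-! ### Branches of systems with countable levels. -/

/-- A system of countable families of subsets of the members of a cofinal `U ⊆ [α]^{≤ω₁}` has only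
countably many relevant branches, and these cover all threads along sufficiently closed `V ⊆ U`. -/
theorem exists_countable_branches {α : Type v} {U : Set (Set α)} (hUZ : U ⊆ smallSets α)
    (hcof : ∀ a ∈ smallSets α, ∃ u ∈ U, a ⊆ u) {D : Set α → Set (Set α)}
    (hD : ∀ u, (D u).Countable) :
    ∃ 𝓑 : Set (Set α), 𝓑.Countable ∧ (∀ B ∈ 𝓑, ∀ u ∈ U, B ∩ u ∈ D u) ∧
      ∃ K : Set α → Set (Set α), (∀ u, (K u).Countable) ∧
        ∀ V ⊆ U, DirectedOn (· ⊆ ·) V → V.Nonempty → (∀ u ∈ V, K u ∩ U ⊆ V) →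
          ∀ t, (∀ u ∈ V, t ∩ u ∈ D u) → ∃ B ∈ 𝓑, ∀ u ∈ V, t ∩ u = B ∩ u := by
  classical
  -- Passing from `D` to `T` makes the system closed under restriction; passing to `E` below
  -- discards the nodes that do not extend to all higher levels.
  let T : Set α → Set (Set α) := fun u =>
    {g | g ∈ D u ∧ g ⊆ u ∧ ∀ u' ∈ U, u' ⊆ u → g ∩ u' ∈ D u'}
  have hTc : ∀ u, (T u).Countable := fun u => (hD u).mono fun g hg => hg.1
  have hTr : ∀ u, ∀ g ∈ T u, ∀ u' ∈ U, u' ⊆ u → g ∩ u' ∈ T u' := by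
    intro u g hg u' hu' hs
    refine ⟨hg.2.2 u' hu' hs, Set.inter_subset_right, fun u'' hu'' hs' => ?_⟩
    rw [Set.inter_assoc, Set.inter_eq_right.2 hs']
    exact hg.2.2 u'' hu'' (hs'.trans hs)
  let E : Set α → Set (Set α) := fun u =>
    {g | g ∈ T u ∧ ∀ u' ∈ U, u ⊆ u' → ∃ g' ∈ T u', g' ∩ u = g}
  have hEc : ∀ u, (E u).Countable := fun u => (hTc u).mono fun g hg => hg.1
  have hw : ∀ u g, g ∈ T u → g ∉ E u → ∃ w ∈ U, u ⊆ w ∧ ∀ g' ∈ T w, g' ∩ u ≠ g := by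
    intro u g hg hgE
    by_contra! hcon
    exact hgE ⟨hg, hcon⟩
  choose! w hwU hwu hw using hw
  -- `r u` is a level above `u` where all dead ends in `T u` have died
  have hr : ∀ u ∈ U, ∃ r ∈ U, u ⊆ r ∧ ∀ g ∈ T u, g ∉ E u → w u g ⊆ r := by
    intro u hu
    obtain ⟨r, hr, hr'⟩ := hcof (u ∪ ⋃₀ ((w u) '' (T u \ E u))) (by
      refine union_mem_smallSets (hUZ hu) (sUnion_mem_smallSets ?_ ?_)
      · exact (((hTc u).mono Set.sdiff_subset).image _).le_aleph0.trans (aleph0_le_aleph 1)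
      · rintro _ ⟨g, hg, rfl⟩
        exact hUZ (hwU u g hg.1 hg.2))
    refine ⟨r, hr, Set.subset_union_left.trans hr', fun g hg hgE => ?_⟩
    exact (Set.subset_sUnion_of_mem (Set.mem_image_of_mem (w u) (Set.mem_sdiff_of_mem hg hgE))).trans
      (Set.subset_union_right.trans hr')
  choose! r hrU hru hr using hr
  have hEr : ∀ u ∈ U, ∀ g ∈ T (r u), g ∩ u ∈ E u := by
    intro u hu g hg
    by_contra hcon
    have h1 : g ∩ u ∈ T u := hTr _ g hg u hu (hru u hu)
    have h2 := hr u hu _ h1 hcon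
    refine hw u _ h1 hcon _ (hTr _ g hg _ (hwU u _ h1 hcon) h2) ?_
    rw [Set.inter_assoc, Set.inter_eq_right.2 (hwu u _ h1 hcon)]
  have hpair : ∀ a ∈ U, ∀ b ∈ U, ∃ c ∈ U, a ⊆ c ∧ b ⊆ c := by
    intro a ha b hb
    obtain ⟨c, hc, hc'⟩ := hcof _ (union_mem_smallSets (hUZ ha) (hUZ hb))
    exact ⟨c, hc, Set.subset_union_left.trans hc', Set.subset_union_right.trans hc'⟩
  have hEext : ∀ u ∈ U, ∀ g ∈ E u, ∀ u' ∈ U, u ⊆ u' → ∃ g' ∈ E u', g' ∩ u = g := by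
    intro u hu g hg u' hu' hs
    obtain ⟨g', hg', rfl⟩ := hg.2 (r u') (hrU u' hu') (hs.trans (hru u' hu'))
    refine ⟨g' ∩ u', hEr u' hu' g' hg', ?_⟩
    rw [Set.inter_assoc, Set.inter_eq_right.2 hs]
  have hEres : ∀ u ∈ U, ∀ u' ∈ U, u ⊆ u' → ∀ g ∈ E u', g ∩ u ∈ E u := by
    intro u hu u' hu' hs g hg
    obtain ⟨c, hc, h1, h2⟩ := hpair u' hu' (r u) (hrU u hu)
    obtain ⟨g', hg', rfl⟩ := hg.2 c hc h1
    have := hEr u hu _ (hTr c g' hg' (r u) (hrU u hu) h2)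
    rw [Set.inter_assoc, Set.inter_eq_right.2 (hru u hu)] at this
    rwa [Set.inter_assoc, Set.inter_eq_right.2 hs]
  have hEsub : ∀ u, ∀ g ∈ E u, g ⊆ u := fun u g hg => hg.1.2.1
  -- Splitting stops at some level. Otherwise there is a chain of `ω₁` levels at each of which a
  -- pair of nodes separates for the first time; lifted to one bound `A`, these are `ω₁` distinct
  -- pairs from the countable set `E A`.
  obtain ⟨a₀, ha₀, hsplit⟩ : ∃ a₀ ∈ U, ∀ u ∈ U, a₀ ⊆ u → ∀ g ∈ E u, ∀ g' ∈ E u,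
      g ∩ a₀ = g' ∩ a₀ → g = g' := by
    by_contra! hcon
    have hnext : ∀ x ∈ smallSets α, ∃ u ∈ U, x ⊆ u ∧ ∃ g ∈ E u, ∃ g' ∈ E u,
        g ∩ x = g' ∩ x ∧ g ≠ g' := by
      intro x hx
      obtain ⟨a, ha, hxa⟩ := hcof x hx
      obtain ⟨u, hu, hau, g, hg, g', hg', h1, h2⟩ := hcon a ha
      refine ⟨u, hu, hxa.trans hau, g, hg, g', hg', ?_, h2⟩
      rw [← Set.inter_eq_right.2 hxa, ← Set.inter_assoc, h1, Set.inter_assoc]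
    choose! nx hnxU hnx hnxs using hnext
    let Ω := (ω₁ : Ordinal.{v}).ToType
    have hΩ : #Ω = ℵ₁ := by simp [Ω]
    let a : Ω → Set α := WellFoundedLT.fix fun ξ f => nx (⋃ η : Set.Iio ξ, f η.1 η.2)
    have ha : ∀ ξ, a ξ = nx (⋃ η : Set.Iio ξ, a η.1) := fun ξ => WellFoundedLT.fix_eq _ _
    have hasm : ∀ ξ, (⋃ η : Set.Iio ξ, a η.1) ∈ smallSets α := by
      intro ξ
      induction ξ using WellFoundedLT.induction with
      | ind ξ ih =>
        refine iUnion_mem_smallSets ((Cardinal.mk_set_le _).trans hΩ.le) ?_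
        rintro ⟨η, hη⟩
        dsimp only
        rw [ha]
        exact hUZ (hnxU _ (ih η hη))
    have haU : ∀ ξ, a ξ ∈ U := fun ξ => by rw [ha]; exact hnxU _ (hasm ξ)
    obtain ⟨A, hA, hAs⟩ := hcof (⋃ ξ, a ξ) (iUnion_mem_smallSets hΩ.le fun ξ => hUZ (haU ξ))
    have hpairs : ∀ ξ, ∃ p : E A × E A, p.1.1 ∩ (⋃ η : Set.Iio ξ, a η.1) =
        p.2.1 ∩ (⋃ η : Set.Iio ξ, a η.1) ∧ p.1.1 ∩ a ξ ≠ p.2.1 ∩ a ξ := by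
      intro ξ
      have haA : a ξ ⊆ A := (Set.subset_iUnion a ξ).trans hAs
      obtain ⟨g, hg, g', hg', h1, h2⟩ := hnxs _ (hasm ξ)
      rw [← ha] at hg hg'
      have hsub : (⋃ η : Set.Iio ξ, a η.1) ⊆ a ξ := by rw [ha ξ]; exact hnx _ (hasm ξ)
      obtain ⟨G, hG, hGg⟩ := hEext _ (haU ξ) g hg A hA haA
      obtain ⟨G', hG', hGg'⟩ := hEext _ (haU ξ) g' hg' A hA haA
      refine ⟨(⟨G, hG⟩, ⟨G', hG'⟩), ?_, ?_⟩
      · dsimp only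
        rw [← Set.inter_eq_right.2 hsub, ← Set.inter_assoc, ← Set.inter_assoc, hGg, hGg', h1]
      · dsimp only
        rwa [hGg, hGg']
    choose P hP1 hP2 using hpairs
    have hinj : ∀ ξ ξ', ξ < ξ' → P ξ ≠ P ξ' := by
      intro ξ ξ' hlt heq
      apply hP2 ξ
      have hsub : a ξ ⊆ ⋃ η : Set.Iio ξ', a η.1 :=
        Set.subset_iUnion (fun η : Set.Iio ξ' => a η.1) ⟨ξ, hlt⟩
      rw [heq, ← Set.inter_eq_right.2 hsub, ← Set.inter_assoc, ← Set.inter_assoc, hP1]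
    have : Countable (E A) := (hEc A).to_subtype
    have hPinj : Function.Injective P := by
      intro ξ ξ' h
      rcases lt_trichotomy ξ ξ' with h' | h' | h'
      · exact (hinj _ _ h' h).elim
      · exact h'
      · exact (hinj _ _ h' h.symm).elim
    have hc : #Ω ≤ ℵ₀ := Cardinal.mk_le_aleph0_iff.2 hPinj.countable
    rw [hΩ, ← succ_aleph0] at hc
    exact (Order.lt_succ ℵ₀).not_ge hc
  -- Above `a₀` nodes of `E` are determined by their trace on `a₀`, so those with trace `g` cohere
  -- and can be glued.
  let br : Set α → Set α := fun g => ⋃₀ {g' | ∃ u ∈ U, a₀ ⊆ u ∧ g' ∈ E u ∧ g' ∩ a₀ = g}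
  have hbr : ∀ u ∈ U, a₀ ⊆ u → ∀ g ∈ E u, br (g ∩ a₀) ∩ u = g := by
    intro u hu hau g hg
    apply Set.Subset.antisymm
    · rintro x ⟨⟨g', ⟨u', hu', hau', hg', heq⟩, hx⟩, hxu⟩
      obtain ⟨c, hc, h1, h2⟩ := hpair u hu u' hu'
      obtain ⟨G, hG, rfl⟩ := hEext u hu g hg c hc h1
      have := hsplit u' hu' hau' (G ∩ u') (hEres u' hu' c hc h2 G hG) g' hg' (by
        rw [heq, Set.inter_assoc, Set.inter_assoc, Set.inter_eq_right.2 hau,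
          Set.inter_eq_right.2 hau'])
      rw [← this] at hx
      exact ⟨hx.1, hxu⟩
    · exact fun x hx => ⟨⟨g, ⟨u, hu, hau, hg, rfl⟩, hx⟩, hEsub u g hg hx⟩
  -- `q u g` locates a failure of `g ∈ T u`. Putting these witnesses into `K u` lets a thread along
  -- `V`, known only to lie in `D`, be recognised as lying in `T`.
  have hq : ∀ u g, ∃ u', g ∈ D u → g ⊆ u → g ∉ T u → u' ∈ U ∧ u' ⊆ u ∧ g ∩ u' ∉ D u' := by
    intro u g
    by_contra! hcon
    obtain ⟨h1, h2, h3, -⟩ := hcon ∅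
    exact h3 ⟨h1, h2, fun u' hu' hs => (hcon u').2.2.2 hu' hs⟩
  choose q hq using hq
  refine ⟨br '' E a₀, (hEc a₀).image _, ?_, fun u => insert a₀ (insert (r u) (q u '' D u)),
    fun u => (((hD u).image _).insert _).insert _, ?_⟩
  · rintro _ ⟨g, hg, rfl⟩ u hu
    obtain ⟨c, hc, h1, h2⟩ := hpair u hu a₀ ha₀
    obtain ⟨G, hG, rfl⟩ := hEext a₀ ha₀ g hg c hc h2
    have := hbr c hc h2 G hG
    have h3 : br (G ∩ a₀) ∩ u = G ∩ u := by
      calc br (G ∩ a₀) ∩ u = br (G ∩ a₀) ∩ c ∩ u := by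
            rw [Set.inter_assoc, Set.inter_eq_right.2 h1]
        _ = G ∩ u := by rw [this]
    rw [h3]
    exact hG.1.2.2 u hu h1
  · intro V hVU hdir hne hVK t ht
    have ha₀V : a₀ ∈ V := by
      obtain ⟨u, hu⟩ := hne
      exact hVK u hu ⟨Or.inl rfl, ha₀⟩
    have hT : ∀ u ∈ V, t ∩ u ∈ T u := by
      intro u hu
      by_contra hcon
      obtain ⟨h1, h2, h3⟩ := hq u (t ∩ u) (ht u hu) Set.inter_subset_right hcon
      refine h3 ?_
      rw [Set.inter_assoc, Set.inter_eq_right.2 h2]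
      exact ht _ (hVK u hu ⟨Or.inr (Or.inr ⟨_, ht u hu, rfl⟩), h1⟩)
    have hE : ∀ u ∈ V, t ∩ u ∈ E u := by
      intro u hu
      have := hEr u (hVU hu) _ (hT (r u) (hVK u hu ⟨Or.inr (Or.inl rfl), hrU u (hVU hu)⟩))
      rwa [Set.inter_assoc, Set.inter_eq_right.2 (hru u (hVU hu))] at this
    refine ⟨br (t ∩ a₀), ⟨_, hE a₀ ha₀V, rfl⟩, fun u hu => ?_⟩
    obtain ⟨c, hc, h1, h2⟩ := hdir u hu a₀ ha₀V
    have := hbr c (hVU hc) h2 _ (hE c hc)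
    rw [Set.inter_assoc, Set.inter_eq_right.2 h2] at this
    rw [← Set.inter_eq_right.2 h1, ← Set.inter_assoc, ← Set.inter_assoc, this]

/-! ### Generic sequences in countable posets from Cohen reals. -/

/-- A descending walk through `Q`, guided by `x : ℕ → Bool`: at time `m`, move to `E m` if `x m` is
true and `E m` is below the present position. -/
noncomputable def guidedWalk {Q : Type v} [LE Q] (E : ℕ → Q) (q : Q) (x : ℕ → Bool) : ℕ → Q
  | 0 => q
  | m + 1 => open Classical in
    if x m = true ∧ E m ≤ guidedWalk E q x m then E m else guidedWalk E q x m

theorem guidedWalk_congr {Q : Type v} [LE Q] {E : ℕ → Q} {q : Q} {x y : ℕ → Bool} {m : ℕ}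
    (h : ∀ n < m, x n = y n) : guidedWalk E q x m = guidedWalk E q y m := by
  induction m with
  | zero => rfl
  | succ m ih =>
    rw [guidedWalk, guidedWalk, ih fun n hn => h n (hn.trans (Nat.lt_succ_self m)),
      h m (Nat.lt_succ_self m)]

theorem guidedWalk_eq_of_false {Q : Type v} [LE Q] {E : ℕ → Q} {q : Q} {x : ℕ → Bool} {m n : ℕ}
    (hmn : m ≤ n) (h : ∀ k, m ≤ k → k < n → x k = false) :
    guidedWalk E q x n = guidedWalk E q x m := by
  induction n, hmn using Nat.le_induction with
  | base => rfl
  | succ n hmn ih =>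
    rw [guidedWalk, if_neg (by simp [h n hmn (Nat.lt_succ_self n)])]
    exact ih fun k hk hkn => h k hk (hkn.trans (Nat.lt_succ_self n))

theorem antitone_guidedWalk {Q : Type v} [Preorder Q] (E : ℕ → Q) (q : Q) (x : ℕ → Bool) :
    Antitone (guidedWalk E q x) :=
  antitone_nat_of_succ_le fun m => by
    rw [guidedWalk]
    split_ifs with h
    · exact h.2
    · exact le_rfl

/-- `MA_{ω₁}(Cohen)` yields generic descending sequences in all countable posets. -/
theorem MACohen.exists_antitone (hMA : MACohen) {Q : Type v} [Preorder Q] [Countable Q]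
    [Nonempty Q] {ι : Type v} (hι : #ι ≤ ℵ₁) (D : ι → Set Q) (hD : ∀ i q, ∃ r ∈ D i, r ≤ q) :
    ∃ s : ℕ → Q, Antitone s ∧ ∀ i, ∃ n, s n ∈ D i := by
  classical
  obtain ⟨f, hf⟩ := exists_surjective_nat Q
  -- Unpairing offers every element of `Q` at arbitrarily late times.
  let E : ℕ → Q := fun m => f m.unpair.1
  have hE : ∀ r m, ∃ n, m ≤ n ∧ E n = r := fun r m => by
    obtain ⟨k, rfl⟩ := hf r
    exact ⟨Nat.pair k m, Nat.right_le_pair k m, by simp [E]⟩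
  let q₀ : Q := f 0
  -- The default `false` makes the walk stand still beyond the domain of `p`.
  let val : CohenPoset → ℕ → Bool := fun p n => decide (true ∈ p.1 n)
  let F : ι → Set CohenPoset := fun i =>
    {p | ∃ m, (∀ n < m, n ∈ p.1.Dom) ∧ guidedWalk E q₀ (val p) m ∈ D i}
  have hF : ∀ i, IsDenseIn (F i) := by
    intro i p
    obtain ⟨m, hm⟩ : ∃ m, ∀ n ∈ p.1.Dom, n < m := by
      obtain ⟨b, hb⟩ := p.2.bddAbove
      exact ⟨b + 1, fun n hn => Nat.lt_succ_of_le (hb hn)⟩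
    obtain ⟨r, hrD, hr⟩ := hD i (guidedWalk E q₀ (val p) m)
    obtain ⟨k, hmk, hk⟩ := hE r m
    -- Pad `p` with `false` and set bit `k`, the time at which `r` is offered. The domain includes
    -- `k`, so the walk is decided up to time `k + 1`, where it sits at `r`.
    let q : ℕ →. Bool := fun n => ⟨n ≤ k, fun _ => val p n || decide (n = k)⟩
    have hqf : q.Dom.Finite := Set.finite_Iic k
    have hqv : ∀ n, n ≤ k → val ⟨q, hqf⟩ n = (val p n || decide (n = k)) := by
      intro n hn
      have : true ∈ q n ↔ (val p n || decide (n = k)) = true :=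
        ⟨fun ⟨_, h⟩ => h, fun h => ⟨hn, h⟩⟩
      rw [Bool.eq_iff_iff, ← this]
      exact decide_eq_true_iff
    have hpn : ∀ n, m ≤ n → val p n = false := by
      intro n hn
      simp only [val, decide_eq_false_iff_not]
      intro h
      exact (hm n h.1).not_ge hn
    refine ⟨⟨q, hqf⟩, ⟨k + 1, fun n hn => Nat.lt_succ_iff.1 hn, ?_⟩, ?_⟩
    · have h1 : guidedWalk E q₀ (val ⟨q, hqf⟩) k = guidedWalk E q₀ (val p) m := by
        rw [← guidedWalk_eq_of_false hmk fun n hn _ => hpn n hn]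
        refine guidedWalk_congr fun n hn => ?_
        rw [hqv n hn.le]
        simp [hn.ne]
      rw [guidedWalk, h1, hqv k le_rfl, if_pos (by simpa [hk] using hr), hk]
      exact hrD
    · intro n b hb
      have hn : n < m := hm n hb.1
      refine ⟨(hn.trans_le hmk).le, ?_⟩
      have : n ≠ k := (hn.trans_le hmk).ne
      change (val p n || decide (n = k)) = b
      simp only [this, decide_false, Bool.or_false, val]
      cases b with
      | true => simpa using hb
      | false =>
        simp only [decide_eq_false_iff_not]
        intro h
        exact absurd (Part.mem_unique h hb) (by simp)
  obtain ⟨G, hG⟩ := hMA (Set.range F) (by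
    have := Cardinal.mk_range_le_lift (f := F)
    rw [← Cardinal.lift_le.{v}]
    refine this.trans ?_
    simpa using hι) (by rintro _ ⟨i, rfl⟩; exact hF i)
  let x : ℕ → Bool := fun n => decide (∃ p ∈ G, true ∈ p.1 n)
  refine ⟨guidedWalk E q₀ x, antitone_guidedWalk E q₀ x, fun i => ?_⟩
  obtain ⟨p, hpG, m, hm, hpD⟩ := hG (F i) ⟨i, rfl⟩
  refine ⟨m, ?_⟩
  rwa [guidedWalk_congr (y := val p)]
  intro n hn
  rw [Bool.eq_iff_iff]
  simp only [x, val, decide_eq_true_eq]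
  refine ⟨?_, fun h => ⟨p, hpG, h⟩⟩
  rintro ⟨p', hp'G, h⟩
  obtain ⟨r, hrG, h1, h2⟩ := G.directed p hpG p' hp'G
  obtain ⟨b, hb⟩ := Part.dom_iff_mem.1 (hm n hn)
  have : b = true := Part.mem_unique (h1 n b hb) (h2 n _ h)
  rwa [← this]

/-! ### The game that controls the trace on `ω₁`. -/

section Game

variable {α Ω : Type v}

/-- The union of all members of `M` that are subsets of `α` of size at most `ω₁`. -/
def smallSupport (M : Set (Ω ⊕ Set α)) : Set α :=
  ⋃₀ {u | u ∈ smallSets α ∧ Sum.inr u ∈ M}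

/-- `M` guesses all `T ∈ L (smallSupport M)` whose restrictions to members of `M` are enumerated by
`e` at places in `M`. -/
def IsGuessing (L : Set α → Set (Set α)) (e : Set α → Ω → Set α) (M : Set (Ω ⊕ Set α)) : Prop :=
  ∀ T ∈ L (smallSupport M), T ⊆ smallSupport M →
    (∀ u ∈ smallSets α, Sum.inr u ∈ M → ∃ β, Sum.inl β ∈ M ∧ T ∩ u = e u β) →
    ∃ B, Sum.inr B ∈ M ∧ T = B ∩ smallSupport M

variable [LinearOrder Ω]

/-- The hull of `P` together with all elements of `Ω` below `δ`. -/
def hullBelow (h : Finset (Ω ⊕ Set α) → Set (Ω ⊕ Set α)) (δ : Ω) (P : Set (Set α)) :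
    Set (Ω ⊕ Set α) :=
  hull h (Sum.inl '' Set.Iio δ ∪ Sum.inr '' P)

/-- The legal answers `(u, c)` to the move `(a, B)` in the game for `δ`: `u` is a small set
covering `a`, and either `B` is accepted (`c = B`), or `B ∩ u` is not enumerated before `δ`. -/
def IsAnswer (e : Set α → Ω → Set α) (δ : Ω) (m x : Set α × Set α) : Prop :=
  x.1 ∈ smallSets α ∧ m.1 ⊆ x.1 ∧ (x.2 = m.2 ∨ ∀ β < δ, e x.1 β ≠ m.2 ∩ x.1)

/-- The first player has no winning strategy in the game in which the second player gives legal
answers, keeping the trace on `Ω` of the hull of `P` and all answers below `δ`. -/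
def IsGoodPosition (h : Finset (Ω ⊕ Set α) → Set (Ω ⊕ Set α)) (e : Set α → Ω → Set α) (δ : Ω)
    (P : Set (Set α)) : Prop :=
  ∀ σ : List (Set α × Set α) → Set α × Set α, (∀ l, (σ l).1 ∈ smallSets α) →
    ∃ r : ℕ → Set α × Set α, (∀ n, IsAnswer e δ (σ ((List.range n).map r)) (r n)) ∧
      ∀ β, Sum.inl β ∈ hullBelow h δ (P ∪ {x | ∃ n, x = (r n).1 ∨ x = (r n).2}) → β < δ

variable {h : Finset (Ω ⊕ Set α) → Set (Ω ⊕ Set α)} {e : Set α → Ω → Set α} {δ : Ω}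
  {P P' : Set (Set α)}

theorem hullBelow_mono (hP : P ⊆ P') : hullBelow h δ P ⊆ hullBelow h δ P' :=
  hull_mono (Set.union_subset_union_right _ (Set.image_mono hP))

theorem empty_mem_smallSets : (∅ : Set α) ∈ smallSets α :=
  mem_smallSets_of_countable Set.countable_empty

theorem IsGoodPosition.mono (hP' : IsGoodPosition h e δ P') (hP : P ⊆ P') :
    IsGoodPosition h e δ P := fun σ hσ => by
  obtain ⟨r, hr, hr'⟩ := hP' σ hσ
  exact ⟨r, hr, fun β hβ => hr' β (hullBelow_mono (Set.union_subset_union_left _ hP) hβ)⟩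

/-- Play against the strategy that always asks `(∅, ∅)`: the resulting hull contains that of `P`. -/
theorem IsGoodPosition.lt_of_mem (hP : IsGoodPosition h e δ P) {β : Ω}
    (hβ : Sum.inl β ∈ hullBelow h δ P) : β < δ := by
  obtain ⟨r, -, hr⟩ := hP (fun _ => (∅, ∅)) fun _ => empty_mem_smallSets
  exact hr β (hullBelow_mono Set.subset_union_left hβ)

/-- If every legal answer led to a bad position, the first player could open with `(a, B)` and
continue with a winning strategy for the position reached, so `P` would be bad. -/
theorem IsGoodPosition.exists_answer (hP : IsGoodPosition h e δ P) {a : Set α}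
    (ha : a ∈ smallSets α) (B : Set α) :
    ∃ x : Set α × Set α, IsAnswer e δ (a, B) x ∧
      IsGoodPosition h e δ (insert x.1 (insert x.2 P)) := by
  classical
  by_contra! hcon
  have hτ : ∀ x, IsAnswer e δ (a, B) x → ∃ τ : List (Set α × Set α) → Set α × Set α,
      (∀ l, (τ l).1 ∈ smallSets α) ∧ ¬ ∃ r : ℕ → Set α × Set α,
        (∀ n, IsAnswer e δ (τ ((List.range n).map r)) (r n)) ∧ ∀ β, Sum.inl β ∈
          hullBelow h δ (insert x.1 (insert x.2 P) ∪ {x | ∃ n, x = (r n).1 ∨ x = (r n).2}) →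
            β < δ := by
    intro x hx
    have := hcon x hx
    unfold IsGoodPosition at this
    push Not at this
    obtain ⟨τ, h1, h2⟩ := this
    refine ⟨τ, h1, ?_⟩
    rintro ⟨r, hr, hr'⟩
    obtain ⟨β, hβ, hβ'⟩ := h2 r hr
    exact hβ'.not_gt (hr' β hβ)
  choose! τ hτZ hτ using hτ
  let σ : List (Set α × Set α) → Set α × Set α := fun l =>
    match l with
    | [] => (a, B)
    | x :: l => if IsAnswer e δ (a, B) x then τ x l else (∅, ∅)
  have hσ : ∀ l, (σ l).1 ∈ smallSets α := by
    intro l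
    cases l with
    | nil => exact ha
    | cons x l =>
      simp only [σ]
      split_ifs with hx
      · exact hτZ x hx l
      · exact empty_mem_smallSets
  obtain ⟨r, hr, hr'⟩ := hP σ hσ
  have h0 : IsAnswer e δ (a, B) (r 0) := by simpa [σ] using hr 0
  refine hτ (r 0) h0 ⟨fun n => r (n + 1), fun n => ?_, fun β hβ => hr' β (hullBelow_mono ?_ hβ)⟩
  · have := hr (n + 1)
    rw [List.range_succ_eq_map, List.map_cons, List.map_map] at this
    simp only [σ, if_pos h0] at this
    exact this
  · rintro x ((rfl | rfl | hx) | ⟨n, hn⟩)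
    · exact Or.inr ⟨0, Or.inl rfl⟩
    · exact Or.inr ⟨0, Or.inr rfl⟩
    · exact Or.inl hx
    · exact Or.inr ⟨n + 1, hn⟩

/-- Suppose the first player wins for every `δ`, by `σ δ`. Take a countable `N` closed under `h` and
under operations treating all these strategies at once. Its trace on `Ω` is an initial segment,
given by some `δ`, and the second player beats `σ δ` by giving only answers in `N`. -/
theorem exists_isGoodPosition [WellFoundedLT Ω] (hΩc : ∀ δ : Ω, (Set.Iio δ).Countable)
    (hΩ : #Ω = ℵ₁) (hh : ∀ E, (h E).Countable) (e : Set α → Ω → Set α) :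
    ∃ δ, IsGoodPosition h e δ ∅ := by
  classical
  by_contra! hcon
  have hσ : ∀ δ, ∃ σ : List (Set α × Set α) → Set α × Set α,
      (∀ l, (σ l).1 ∈ smallSets α) ∧ ¬ ∃ r : ℕ → Set α × Set α,
        (∀ n, IsAnswer e δ (σ ((List.range n).map r)) (r n)) ∧ ∀ β, Sum.inl β ∈
          hullBelow h δ (∅ ∪ {x | ∃ n, x = (r n).1 ∨ x = (r n).2}) → β < δ := by
    intro δ
    have := hcon δ
    unfold IsGoodPosition at this
    push Not at this
    obtain ⟨τ, h1, h2⟩ := this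
    refine ⟨τ, h1, ?_⟩
    rintro ⟨r, hr, hr'⟩
    obtain ⟨β, hβ, hβ'⟩ := h2 r hr
    exact hβ'.not_gt (hr' β hβ)
  choose σ hσZ hσ using hσ
  have hsep : ∀ B B' : Set α, ∃ s : Set α, s.Countable ∧ (B ≠ B' → B ∩ s ≠ B' ∩ s) := by
    intro B B'
    by_cases hB : B = B'
    · exact ⟨∅, Set.countable_empty, fun h => (h hB).elim⟩
    · obtain ⟨x, hx⟩ : ∃ x, ¬ (x ∈ B ↔ x ∈ B') := by
        by_contra! hall
        exact hB (Set.ext hall)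
      refine ⟨{x}, Set.countable_singleton x, fun _ heq => hx ?_⟩
      have := Set.ext_iff.1 heq x
      simpa using this
  choose s hsc hs using hsep
  -- `A l` covers what all the strategies demand after `l` and separates all the sets they propose.
  -- So a proposed set is determined by `l` and an index of its trace on `A l`, without reference to
  -- `δ ∉ N`.
  let A : List (Set α × Set α) → Set α := fun l =>
    (⋃ δ, (σ δ l).1) ∪ ⋃ p : Ω × Ω, s (σ p.1 l).2 (σ p.2 l).2
  have hAZ : ∀ l, A l ∈ smallSets α := fun l =>
    union_mem_smallSets (iUnion_mem_smallSets hΩ.le fun δ => hσZ δ l)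
      (iUnion_mem_smallSets (by
        rw [Cardinal.mk_prod, Cardinal.lift_id, hΩ]
        exact (Cardinal.mul_eq_self (aleph0_le_aleph 1)).le)
        fun p => mem_smallSets_of_countable (hsc _ _))
  have hAsep : ∀ l i j, (σ i l).2 ∩ A l = (σ j l).2 ∩ A l → (σ i l).2 = (σ j l).2 := by
    intro l i j heq
    by_contra hne
    refine hs _ _ hne ?_
    have hsub : s (σ i l).2 (σ j l).2 ⊆ A l :=
      (Set.subset_iUnion (fun p : Ω × Ω => s (σ p.1 l).2 (σ p.2 l).2) (i, j)).trans
        Set.subset_union_right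
    rw [← Set.inter_eq_right.2 hsub, ← Set.inter_assoc, ← Set.inter_assoc, heq]
  let S : Finset (Ω ⊕ Set α) → Set (List (Set α × Set α)) := fun E =>
    {l | ∀ x ∈ l, Sum.inr x.1 ∈ E ∧ Sum.inr x.2 ∈ E}
  have hS : ∀ E, (S E).Countable := by
    intro E
    let R : Set (Set α × Set α) := {x | Sum.inr x.1 ∈ E ∧ Sum.inr x.2 ∈ E}
    have hR : R.Finite := by
      have h1 : ({u | Sum.inr u ∈ E} : Set (Set α)).Finite :=
        E.finite_toSet.preimage Sum.inr_injective.injOn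
      exact (h1.prod h1).subset fun x hx => ⟨hx.1, hx.2⟩
    have : Countable R := hR.countable.to_subtype
    refine (Set.countable_range (List.map (Subtype.val : R → Set α × Set α))).mono ?_
    intro l hl
    exact ⟨l.attach.map fun x => ⟨x.1, hl x.1 x.2⟩, by
        rw [List.map_map]
        exact List.attach_map_subtype_val l⟩
  let ans : List (Set α × Set α) → Ω → Set (Set α) := fun l β =>
    {B | (∃ i, B = (σ i l).2) ∧ e (A l) β = B ∩ A l}
  have hans : ∀ l β, (ans l β).Subsingleton := by
    rintro l β _ ⟨⟨i, rfl⟩, hi⟩ _ ⟨⟨j, rfl⟩, hj⟩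
    exact hAsep l i j (hi.symm.trans hj)
  let Φ : Finset (Ω ⊕ Set α) → Set (Ω ⊕ Set α) := fun E =>
    h E ∪ (⋃ γ ∈ {γ | Sum.inl γ ∈ E}, Sum.inl '' Set.Iio γ) ∪
      ⋃ l ∈ S E, insert (Sum.inr (A l)) (⋃ β ∈ {β | Sum.inl β ∈ E}, Sum.inr '' ans l β)
  have hEc : ∀ E : Finset (Ω ⊕ Set α), {γ | Sum.inl γ ∈ E}.Countable := fun E =>
    (E.finite_toSet.preimage Sum.inl_injective.injOn).countable
  have hΦ : ∀ E, (Φ E).Countable := fun E =>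
    ((hh E).union ((hEc E).biUnion fun γ _ => (hΩc γ).image _)).union
      ((hS E).biUnion fun l _ => ((hEc E).biUnion fun β _ =>
        (hans l β).countable.image _).insert _)
  let N := hull Φ ∅
  have hN : IsClosedUnder Φ N := isClosedUnder_hull
  have hNc : N.Countable := countable_hull hΦ Set.countable_empty
  have hNdown : ∀ γ, Sum.inl γ ∈ N → ∀ β < γ, Sum.inl β ∈ N := by
    intro γ hγ β hβ
    refine hN {Sum.inl γ} (by simpa using hγ) (Or.inl (Or.inr ?_))
    exact Set.mem_biUnion (x := γ) (by simp) ⟨β, hβ, rfl⟩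
  have hNh : IsClosedUnder h N := hN.mono fun E =>
    Set.subset_union_left.trans Set.subset_union_left
  -- a finite subset of `N` carrying a list
  have hcode : ∀ l : List (Set α × Set α), (∀ x ∈ l, Sum.inr x.1 ∈ N ∧ Sum.inr x.2 ∈ N) →
      ∃ E : Finset (Ω ⊕ Set α), ↑E ⊆ N ∧ l ∈ S E := by
    intro l hl
    refine ⟨l.toFinset.image (fun x => Sum.inr x.1) ∪ l.toFinset.image (fun x => Sum.inr x.2),
      ?_, ?_⟩
    · intro y hy
      simp only [Finset.coe_union, Finset.coe_image, Set.mem_union, Set.mem_image,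
        Finset.mem_coe, List.mem_toFinset] at hy
      rcases hy with ⟨x, hx, rfl⟩ | ⟨x, hx, rfl⟩
      · exact (hl x hx).1
      · exact (hl x hx).2
    · intro x hx
      refine ⟨Finset.mem_union_left _ (Finset.mem_image.2 ⟨x, by simpa using hx, rfl⟩),
        Finset.mem_union_right _ (Finset.mem_image.2 ⟨x, by simpa using hx, rfl⟩)⟩
  have hNA : ∀ l : List (Set α × Set α), (∀ x ∈ l, Sum.inr x.1 ∈ N ∧ Sum.inr x.2 ∈ N) →
      Sum.inr (A l) ∈ N := by
    intro l hl
    obtain ⟨E, hE, hlE⟩ := hcode l hl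
    exact hN E hE (Or.inr (Set.mem_biUnion hlE (Or.inl rfl)))
  have hNB : ∀ l : List (Set α × Set α), (∀ x ∈ l, Sum.inr x.1 ∈ N ∧ Sum.inr x.2 ∈ N) →
      ∀ β, Sum.inl β ∈ N → ∀ B ∈ ans l β, Sum.inr B ∈ N := by
    intro l hl β hβ B hB
    obtain ⟨E, hE, hlE⟩ := hcode l hl
    refine hN (insert (Sum.inl β) E) ?_ (Or.inr (Set.mem_biUnion (x := l) ?_ (Or.inr
      (Set.mem_biUnion (x := β) ?_ ⟨B, hB, rfl⟩))))
    · rw [Finset.coe_insert]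
      exact Set.insert_subset hβ hE
    · intro x hx
      exact ⟨Finset.mem_insert_of_mem (hlE x hx).1, Finset.mem_insert_of_mem (hlE x hx).2⟩
    · exact Finset.mem_insert_self _ _
  obtain ⟨δ, hδN, hδ⟩ : ∃ δ, Sum.inl δ ∉ N ∧ ∀ β < δ, Sum.inl β ∈ N := by
    have hne : ({δ | Sum.inl δ ∉ N} : Set Ω).Nonempty := by
      by_contra hemp
      rw [Set.not_nonempty_iff_eq_empty] at hemp
      have huniv : Set.univ ⊆ (Sum.inl ⁻¹' N : Set Ω) := fun δ _ => by
        by_contra hδ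
        exact (Set.ext_iff.1 hemp δ).1 hδ
      have hc : (Set.univ : Set Ω).Countable :=
        (hNc.preimage_of_injOn Sum.inl_injective.injOn).mono huniv
      have : #Ω ≤ ℵ₀ := Cardinal.mk_le_aleph0_iff.2 (Set.countable_univ_iff.1 hc)
      rw [hΩ, ← succ_aleph0] at this
      exact (Order.lt_succ ℵ₀).not_ge this
    refine ⟨wellFounded_lt.min _ hne, wellFounded_lt.min_mem _ hne, fun β hβ => ?_⟩
    by_contra hβN
    exact wellFounded_lt.not_lt_min _ hβN hβ
  have hδ' : ∀ β, Sum.inl β ∈ N → β < δ := by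
    intro β hβ
    by_contra hle
    rcases (not_lt.1 hle).eq_or_lt with heq | hlt
    · exact hδN (heq ▸ hβ)
    · exact hδN (hNdown β hβ δ hlt)
  -- A proposed set whose trace has an index below `δ` lies in `N` by `hNB` and is accepted.
  -- Otherwise refusal is legal, with `A l` serving as a filler in `N`.
  let mv : List (Set α × Set α) → Set α × Set α := fun l =>
    (A l, if ∃ β < δ, e (A l) β = (σ δ l).2 ∩ A l then (σ δ l).2 else A l)
  have hmv : ∀ l, IsAnswer e δ (σ δ l) (mv l) := by
    intro l
    refine ⟨hAZ l, (Set.subset_iUnion (fun δ => (σ δ l).1) δ).trans Set.subset_union_left, ?_⟩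
    simp only [mv]
    split_ifs with hβ
    · exact Or.inl rfl
    · push Not at hβ
      exact Or.inr hβ
  have hmvN : ∀ l : List (Set α × Set α), (∀ x ∈ l, Sum.inr x.1 ∈ N ∧ Sum.inr x.2 ∈ N) →
      Sum.inr (mv l).1 ∈ N ∧ Sum.inr (mv l).2 ∈ N := by
    intro l hl
    refine ⟨hNA l hl, ?_⟩
    simp only [mv]
    split_ifs with hβ
    · obtain ⟨β, hβ, heq⟩ := hβ
      exact hNB l hl β (hδ β hβ) _ ⟨⟨δ, rfl⟩, heq⟩
    · exact hNA l hl
  let H : ℕ → List (Set α × Set α) := fun n => Nat.rec [] (fun _ l => l ++ [mv l]) n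
  have hHs : ∀ n, H (n + 1) = H n ++ [mv (H n)] := fun _ => rfl
  have hH : ∀ n, (List.range n).map (fun k => mv (H k)) = H n := by
    intro n
    induction n with
    | zero => rfl
    | succ n ih => rw [List.range_succ, List.map_append, ih, hHs]; rfl
  have hHN : ∀ n, ∀ x ∈ H n, Sum.inr x.1 ∈ N ∧ Sum.inr x.2 ∈ N := by
    intro n
    induction n with
    | zero => intro x hx; cases hx
    | succ n ih =>
      intro x hx
      rw [hHs, List.mem_append, List.mem_singleton] at hx
      rcases hx with hx | rfl
      · exact ih x hx
      · exact hmvN _ ih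
  refine hσ δ ⟨fun n => mv (H n), fun n => ?_, fun β hβ => hδ' β (hull_subset ?_ hNh hβ)⟩
  · rw [hH]
    exact hmv _
  · rintro _ (⟨β, hβ, rfl⟩ | ⟨x, hx, rfl⟩)
    · exact hδ β hβ
    · rcases hx with hx | ⟨n, rfl | rfl⟩
      · exact hx.elim
      · exact (hmvN _ (hHN n)).1
      · exact (hmvN _ (hHN n)).2

end Game

/-! ### Stationarily many guessing sets. -/

/-- Under `MA_{ω₁}(Cohen)` there are stationarily many guessing sets. -/
theorem exists_isGuessing {α Ω : Type v} [LinearOrder Ω] [WellFoundedLT Ω] (hMA : MACohen)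
    (hΩc : ∀ δ : Ω, (Set.Iio δ).Countable) (hΩ : #Ω = ℵ₁) (L : Set α → Set (Set α))
    (hL : ∀ W ∈ smallSets α, #(L W) ≤ ℵ₁) (e : Set α → Ω → Set α)
    (h : Finset (Ω ⊕ Set α) → Set (Ω ⊕ Set α)) (hh : ∀ E, (h E).Countable) :
    ∃ M : Set (Ω ⊕ Set α), M.Countable ∧ IsClosedUnder h M ∧ IsGuessing L e M := by
  classical
  obtain ⟨δ, hδ⟩ := exists_isGoodPosition hΩc hΩ hh e
  let D : Set α → Set (Set α) := fun u => e u '' Set.Iio δ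
  have hD : ∀ u, (D u).Countable := fun u => (hΩc δ).image _
  let G : Set (Set α) → Prop := IsGoodPosition h e δ
  let U : Set (Set α) → Set (Set α) := fun P => {u | u ∈ smallSets α ∧ G (insert u P)}
  have hU : ∀ P, G P → ∀ a ∈ smallSets α, ∃ u ∈ U P, a ⊆ u := by
    intro P hP a ha
    obtain ⟨x, hx, hG⟩ := hP.exists_answer ha ∅
    exact ⟨x.1, ⟨hx.1, hG.mono (Set.insert_subset_insert (Set.subset_insert _ _))⟩, hx.2.1⟩
  -- The levels are the sets that can be added to `P`, and the families consist of the entries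
  -- enumerated before `δ`; `𝓑 P` is the resulting countable set of branches.
  have hbr := fun P hP => exists_countable_branches (U := U P) (fun u hu => hu.1) (hU P hP) hD
  choose! 𝓑 h𝓑c h𝓑 K hKc hK using hbr
  have hans := fun P (hP : G P) a (ha : a ∈ smallSets α) B => hP.exists_answer ha B
  choose! x hx hxG using hans
  let Φ : Finset (Set α) → Set (Set α) := fun E =>
    (⋃ P ∈ {P : Finset (Set α) | P ⊆ E ∧ G P}, (Sum.inr ⁻¹' hullBelow h δ P ∪ 𝓑 P) ∪
      ((⋃ a ∈ E, K P a) ∪ ⋃ a ∈ E, ⋃ B ∈ E, {(x P a B).1, (x P a B).2})) ∪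
    Set.image2 (· ∪ ·) E E
  have hPc : ∀ P : Set (Set α), P.Countable → (hullBelow h δ P).Countable := fun P hP =>
    countable_hull hh (((hΩc δ).image _).union (hP.image _))
  have hΦ : ∀ E, (Φ E).Countable := by
    intro E
    refine Set.Countable.union (Set.Countable.biUnion ?_ ?_)
      (E.countable_toSet.image2 E.countable_toSet _)
    · exact ((E.powerset.finite_toSet.subset fun P hP => Finset.mem_powerset.2 hP.1)).countable
    · intro P hP
      exact (((hPc P P.countable_toSet).preimage_of_injOn Sum.inr_injective.injOn).union
        (h𝓑c P hP.2)).union ((E.countable_toSet.biUnion fun a _ => hKc P hP.2 a).union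
        (E.countable_toSet.biUnion fun a _ => E.countable_toSet.biUnion fun B _ =>
          (Set.toFinite _).countable))
  -- `Y` is fixed before the generic sequence. It keeps the poset of positions countable and
  -- determines the support `W` of `M` in advance, so that only the at most `ω₁` members of `L W`
  -- have to be treated.
  let Y := hull Φ {∅}
  have hY : IsClosedUnder Φ Y := isClosedUnder_hull
  have hYc : Y.Countable := countable_hull hΦ (Set.countable_singleton _)
  have hY0 : ∅ ∈ Y := subset_hull rfl
  have hYun : ∀ a ∈ Y, ∀ b ∈ Y, a ∪ b ∈ Y := by
    intro a ha b hb
    refine hY {a, b} ?_ (Or.inr ⟨a, by simp, b, by simp, rfl⟩)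
    rw [Finset.coe_pair]
    exact Set.insert_subset ha (Set.singleton_subset_iff.2 hb)
  have hYP : ∀ P : Finset (Set α), ↑P ⊆ Y → G P →
      Sum.inr ⁻¹' hullBelow h δ P ⊆ Y ∧ 𝓑 P ⊆ Y := by
    intro P hPY hPG
    rw [← Set.union_subset_iff]
    refine Set.Subset.trans ?_ (hY P hPY)
    refine Set.Subset.trans ?_ Set.subset_union_left
    intro y hy
    exact Set.mem_biUnion (x := P) ⟨Finset.Subset.refl P, hPG⟩ (Or.inl hy)
  have hYK : ∀ P : Finset (Set α), ↑P ⊆ Y → G P → ∀ a ∈ Y, K P a ⊆ Y := by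
    intro P hPY hPG a ha y hy
    refine hY (insert a P) (by rw [Finset.coe_insert]; exact Set.insert_subset ha hPY) (Or.inl ?_)
    exact Set.mem_biUnion (x := P) ⟨Finset.subset_insert _ _, hPG⟩
      (Or.inr (Or.inl (Set.mem_biUnion (x := a) (Finset.mem_insert_self _ _) hy)))
  have hYx : ∀ P : Finset (Set α), ↑P ⊆ Y → G P → ∀ a ∈ Y, ∀ B ∈ Y,
      (x P a B).1 ∈ Y ∧ (x P a B).2 ∈ Y := by
    intro P hPY hPG a ha B hB
    rw [← Set.singleton_subset_iff (a := (x P a B).2), ← Set.insert_subset_iff]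
    refine Set.Subset.trans ?_ (hY (insert a (insert B P)) (by
      rw [Finset.coe_insert, Finset.coe_insert]
      exact Set.insert_subset ha (Set.insert_subset hB hPY)))
    refine Set.Subset.trans ?_ Set.subset_union_left
    intro y hy
    exact Set.mem_biUnion (x := P) ⟨(Finset.subset_insert _ _).trans (Finset.subset_insert _ _), hPG⟩
      (Or.inr (Or.inr (Set.mem_biUnion (x := a) (by simp) (Set.mem_biUnion (x := B) (by simp) hy))))
  let W : Set α := ⋃₀ {u | u ∈ smallSets α ∧ u ∈ Y}
  have hW : W ∈ smallSets α := sUnion_mem_smallSets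
    ((hYc.mono fun u hu => hu.2).le_aleph0.trans (aleph0_le_aleph 1)) fun u hu => hu.1
  let Q₀ := {P : Finset (Set α) // ↑P ⊆ Y ∧ G P}
  let Q := Q₀ᵒᵈ
  have hQ₀ : Countable Q₀ := by
    have : {P : Finset (Set α) | ↑P ⊆ Y ∧ G P}.Countable :=
      (countable_finset_subset hYc).mono fun P hP => hP.1
    exact this.to_subtype
  have : Countable Q := hQ₀
  have : Nonempty Q := ⟨OrderDual.toDual ⟨∅, by simp, by simpa [G] using hδ⟩⟩
  let DT : Set α → Set Q := fun T => {P | T ⊆ W →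
    (∃ u ∈ (OrderDual.ofDual P).1, u ∈ smallSets α ∧ T ∩ u ∉ D u) ∨
      ∃ B ∈ (OrderDual.ofDual P).1, T = B ∩ W}
  let DY : Set α → Set Q := fun w => {P | ∃ u ∈ (OrderDual.ofDual P).1, u ∈ smallSets α ∧ w ⊆ u}
  have hext : ∀ P : Q₀, ∀ a ∈ Y, a ∈ smallSets α → ∀ B ∈ Y, ∃ P' : Q₀, P.1 ⊆ P'.1 ∧
      (x P.1 a B).1 ∈ P'.1 ∧ (x P.1 a B).2 ∈ P'.1 := by
    intro P a haY ha B hB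
    obtain ⟨h1, h2⟩ := hYx P.1 P.2.1 P.2.2 a haY B hB
    refine ⟨⟨insert (x P.1 a B).1 (insert (x P.1 a B).2 P.1), ?_, ?_⟩, ?_, ?_, ?_⟩
    · rw [Finset.coe_insert, Finset.coe_insert]
      exact Set.insert_subset h1 (Set.insert_subset h2 P.2.1)
    · rw [Finset.coe_insert, Finset.coe_insert]
      exact hxG P.1 P.2.2 a ha B
    · exact (Finset.subset_insert _ _).trans (Finset.subset_insert _ _)
    · exact Finset.mem_insert_self _ _
    · exact Finset.mem_insert_of_mem (Finset.mem_insert_self _ _)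
  have hDY : ∀ w ∈ smallSets α, w ∈ Y → ∀ P : Q, ∃ R ∈ DY w, R ≤ P := by
    intro w hw hwY P
    obtain ⟨P', h1, h2, -⟩ := hext (OrderDual.ofDual P) w hwY hw ∅ hY0
    have := hx _ (OrderDual.ofDual P).2.2 w hw ∅
    exact ⟨OrderDual.toDual P', ⟨_, h2, this.1, this.2.1⟩, h1⟩
  have hDT : ∀ T (P : Q), ∃ R ∈ DT T, R ≤ P := by
    intro T P
    by_cases hTW : T ⊆ W
    swap
    · exact ⟨P, fun h => (hTW h).elim, le_rfl⟩
    by_cases hkill : ∃ P' : Q₀, (OrderDual.ofDual P).1 ⊆ P'.1 ∧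
        ∃ u ∈ P'.1, u ∈ smallSets α ∧ T ∩ u ∉ D u
    · obtain ⟨P', h1, h2⟩ := hkill
      exact ⟨OrderDual.toDual P', fun _ => Or.inl h2, h1⟩
    push Not at hkill
    generalize hp : OrderDual.ofDual P = p at hkill
    -- the thread given by `T` is a branch of the system of the `D u`
    have hUT : ∀ u ∈ U p.1 ∩ Y, T ∩ u ∈ D u := by
      intro u hu
      refine hkill ⟨insert u p.1, ?_, ?_⟩ (Finset.subset_insert _ _) u
        (Finset.mem_insert_self _ _) hu.1.1
      · rw [Finset.coe_insert]
        exact Set.insert_subset hu.2 p.2.1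
      · rw [Finset.coe_insert]
        exact hu.1.2
    have hcofY : ∀ a ∈ Y, a ∈ smallSets α → ∃ u ∈ U p.1 ∩ Y, a ⊆ u := by
      intro a haY ha
      have h1 := hx p.1 p.2.2 a ha ∅
      have h2 := hYx p.1 p.2.1 p.2.2 a haY ∅ hY0
      exact ⟨_, ⟨⟨h1.1, (hxG p.1 p.2.2 a ha ∅).mono
        (Set.insert_subset_insert (Set.subset_insert _ _))⟩, h2.1⟩, h1.2.1⟩
    obtain ⟨B, hB, hBT⟩ := hK p.1 p.2.2 (U p.1 ∩ Y) Set.inter_subset_left (by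
      intro a ha b hb
      obtain ⟨u, hu, hu'⟩ := hcofY _ (hYun a ha.2 b hb.2) (union_mem_smallSets ha.1.1 hb.1.1)
      exact ⟨u, hu, Set.subset_union_left.trans hu', Set.subset_union_right.trans hu'⟩) (by
      obtain ⟨u, hu, -⟩ := hcofY ∅ hY0 empty_mem_smallSets
      exact ⟨u, hu⟩)
      (fun u hu y hy => ⟨hy.2, hYK p.1 p.2.1 p.2.2 u hu.2 hy.1⟩) T hUT
    have hBY : B ∈ Y := (hYP p.1 p.2.1 p.2.2).2 hB
    have hTB : T = B ∩ W := by
      ext y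
      constructor
      · intro hy
        refine ⟨?_, hTW hy⟩
        obtain ⟨a, ⟨ha, haY⟩, hya⟩ := hTW hy
        obtain ⟨u, hu, hau⟩ := hcofY a haY ha
        have : y ∈ T ∩ u := ⟨hy, hau hya⟩
        rw [hBT u hu] at this
        exact this.1
      · rintro ⟨hy, a, ⟨ha, haY⟩, hya⟩
        obtain ⟨u, hu, hau⟩ := hcofY a haY ha
        have : y ∈ B ∩ u := ⟨hy, hau hya⟩
        rw [← hBT u hu] at this
        exact this.1
    obtain ⟨P', h1, -, h2⟩ := hext p ∅ hY0 empty_mem_smallSets B hBY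
    have hxu := hx p.1 p.2.2 ∅ empty_mem_smallSets B
    -- `B` cannot be refused: that would need a `u` in `U p` such that `B ∩ u` has no index below
    -- `δ`, while `B` is a branch over `U p`.
    have hxB : (x p.1 ∅ B).2 = B := by
      refine hxu.2.2.resolve_right fun hno => ?_
      obtain ⟨β, hβ, hβ'⟩ := h𝓑 p.1 p.2.2 B hB (x p.1 ∅ B).1 ⟨hxu.1,
        (hxG p.1 p.2.2 ∅ empty_mem_smallSets B).mono
          (Set.insert_subset_insert (Set.subset_insert _ _))⟩
      exact hno β hβ hβ'
    rw [hxB] at h2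
    refine ⟨OrderDual.toDual P', fun _ => Or.inr ⟨B, h2, hTB⟩, ?_⟩
    rw [← hp] at h1
    exact h1
  obtain ⟨s, hs, hsD⟩ := hMA.exists_antitone (Q := Q)
    (ι := L W ⊕ {w | w ∈ smallSets α ∧ w ∈ Y}) (by
      rw [Cardinal.mk_sum, Cardinal.lift_id, Cardinal.lift_id]
      refine (add_le_add (hL W hW) (((hYc.mono fun u hu => hu.2).le_aleph0).trans
        (aleph0_le_aleph 1))).trans (Cardinal.add_eq_self (aleph0_le_aleph 1)).le)
    (Sum.elim (fun T => DT T) fun w => DY w) (by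
      rintro (T | w) P
      · exact hDT T P
      · exact hDY w w.2.1 w.2.2 P)
  let p : ℕ → Q₀ := fun n => OrderDual.ofDual (s n)
  have hpm : Monotone fun n => hullBelow h δ (p n).1 := fun m n hmn =>
    hullBelow_mono (Finset.coe_subset.2 (hs hmn))
  let M : Set (Ω ⊕ Set α) := ⋃ n, hullBelow h δ (p n).1
  have hpM : ∀ n, ∀ u ∈ (p n).1, Sum.inr u ∈ M := fun n u hu =>
    Set.mem_iUnion.2 ⟨n, subset_hull (Or.inr ⟨u, hu, rfl⟩)⟩
  have hMY : ∀ u, Sum.inr u ∈ M → u ∈ Y := by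
    intro u hu
    obtain ⟨n, hn⟩ := Set.mem_iUnion.1 hu
    exact (hYP (p n).1 (p n).2.1 (p n).2.2).1 hn
  -- Goodness of the positions enters here. It rules out the first alternative in `DT T` as soon as
  -- all restrictions of `T` to members of `M` have indices in `M`.
  have hMδ : ∀ β, Sum.inl β ∈ M → β < δ := by
    intro β hβ
    obtain ⟨n, hn⟩ := Set.mem_iUnion.1 hβ
    exact (p n).2.2.lt_of_mem hn
  have hMW : smallSupport M = W := by
    apply Set.Subset.antisymm
    · exact Set.sUnion_subset_sUnion fun u hu => ⟨hu.1, hMY u hu.2⟩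
    · rintro y ⟨w, hw, hyw⟩
      obtain ⟨n, u, hu, huZ, hwu⟩ := hsD (Sum.inr ⟨w, hw⟩)
      exact ⟨u, ⟨huZ, hpM n u hu⟩, hwu hyw⟩
  refine ⟨M, Set.countable_iUnion fun n => hPc _ (p n).1.countable_toSet,
    IsClosedUnder.iUnion_of_directed hpm.directed_le fun n => isClosedUnder_hull, ?_⟩
  intro T hT hTs happ
  rw [hMW] at hT hTs ⊢
  obtain ⟨n, hn⟩ := hsD (Sum.inl ⟨T, hT⟩)
  rcases hn hTs with ⟨u, hu, huZ, huD⟩ | ⟨B, hB, hTB⟩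
  · obtain ⟨β, hβ, hβ'⟩ := happ u huZ (hpM n u hu)
    exact (huD ⟨β, hMδ β hβ, hβ'.symm⟩).elim
  · exact ⟨B, hpM n B hB, hTB⟩

/-! ### Reflection for families of subsets of `ω₁ ⊕ 𝒫(l)`. -/

section Transfer

variable {X Y : Type v}

/-- Sets guaranteed by `h𝒮` are stationary after transport along a bijection. -/
theorem isStationaryOmega_preimage [Infinite X] (φ : X ≃ Y) {𝒮 : Set (Set X)}
    (h𝒮 : ∀ h : Finset X → Set X, (∀ E, (h E).Countable) →
      ∃ M ∈ 𝒮, M.Countable ∧ IsClosedUnder h M) :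
    IsStationaryOmega (Set.univ : Set Y) {y | #y = ℵ₀ ∧ φ ⁻¹' y ∈ 𝒮} := by
  classical
  have hω : (ℵ₀ : Cardinal.{v}) < ℵ₁ := by rw [← succ_aleph0]; exact Order.lt_succ _
  refine ⟨fun y hy => ⟨Set.subset_univ _, hy.1⟩,
    fun y hy => ⟨Set.subset_univ _, by rw [hy.1]; exact hω⟩, fun C hC => ?_⟩
  obtain ⟨h, hh, -, hC'⟩ := hC.exists_closedUnder
  -- An infinite set added to all values forces closed sets to be infinite, as membership in `[Y]^ω`
  -- requires.
  let seed : Set X := Set.range (Infinite.natEmbedding X)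
  obtain ⟨M, hM, hMc, hMh⟩ := h𝒮 (fun E => φ ⁻¹' h (E.map φ.toEmbedding) ∪ seed) fun E =>
    ((hh _).preimage_of_injOn φ.injective.injOn).union (Set.countable_range _)
  have hpre : φ ⁻¹' (φ '' M) = M := φ.injective.preimage_image M
  refine ⟨φ '' M, ⟨?_, by rwa [hpre]⟩, hC' _ (Set.subset_univ _) (hMc.image φ) ?_⟩
  · have hinf : M.Infinite := by
      refine Set.Infinite.mono ?_ (Set.infinite_range_of_injective (Infinite.natEmbedding X).injective)
      exact Set.subset_union_right.trans (hMh ∅ (by simp))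
    have h1 := (hinf.image φ.injective.injOn).to_subtype
    exact le_antisymm (hMc.image φ).le_aleph0 (Cardinal.aleph0_le_mk _)
  · intro E hE y hy
    have hE' : ↑(E.map φ.symm.toEmbedding) ⊆ M := by
      intro x hx
      rw [Finset.coe_map] at hx
      obtain ⟨z, hz, rfl⟩ := hx
      obtain ⟨x, hx, rfl⟩ := hE hz
      simpa using hx
    refine ⟨φ.symm y, hMh _ hE' (Or.inl ?_), by simp⟩
    have : (E.map φ.symm.toEmbedding).map φ.toEmbedding = E := by
      ext z
      simp
    rw [this]
    simpa using hy

/-- A reflection point, transported back along a bijection. -/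
theorem exists_of_isStationaryOmega (φ : X ≃ Y) {𝒮 : Set (Set X)} {I : Set Y}
    (hI : IsStationaryOmega I ({y | #y = ℵ₀ ∧ φ ⁻¹' y ∈ 𝒮} ∩ omegaSubsets I))
    (h : Finset X → Set X) (hh : ∀ E, (h E).Countable) :
    ∃ M ∈ 𝒮, M ⊆ φ ⁻¹' I ∧ M.Countable ∧ IsClosedUnder (fun E => h E ∩ φ ⁻¹' I) M := by
  classical
  obtain ⟨y, ⟨⟨-, hy⟩, -⟩, hyI, hyc, hyh⟩ := hI.2.2 _ (isClubIn_closedUnder (A := I)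
    (h := fun E : Finset Y => φ '' h (E.map φ.symm.toEmbedding)) fun E => (hh _).image _)
  refine ⟨φ ⁻¹' y, hy, Set.preimage_mono hyI, hyc.preimage_of_injOn φ.injective.injOn, ?_⟩
  intro E hE x hx
  refine hyh (E.map φ.toEmbedding) ?_ ⟨⟨x, ?_, rfl⟩, hx.2⟩
  · rw [Finset.coe_map]
    rintro _ ⟨z, hz, rfl⟩
    exact hE hz
  · have : (E.map φ.toEmbedding).map φ.symm.toEmbedding = E := by
      ext z
      simp
    rw [this]
    exact hx.1

end Transfer

/-- `ω₁` together with the power set of an ordinal can be enumerated by an ordinal, with `ω₁` as an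
initial segment. -/
theorem exists_equiv_Iio (l : Ordinal.{u}) (hl : ω_ 2 ≤ l) :
    ∃ l' : Ordinal.{u}, ω_ 2 ≤ l' ∧
      ∃ φ : (Set.Iio (ω₁ : Ordinal.{u}) ⊕ Set (Set.Iio l)) ≃ Set.Iio l',
        φ ⁻¹' omegaOneIn l' = Set.range Sum.inl := by
  let o : Ordinal.{u} := (2 ^ l.card : Cardinal.{u}).ord
  have ho : #(Set (Set.Iio l)) = #(Set.Iio o) := by
    rw [Cardinal.mk_set, Cardinal.mk_Iio_ordinal, Cardinal.mk_Iio_ordinal, Cardinal.card_ord,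
      Cardinal.lift_power, Cardinal.lift_two]
  obtain ⟨ψ⟩ := Cardinal.eq.1 ho
  have h2 : ω_ 2 ≤ o := by
    rw [← Cardinal.ord_aleph]
    refine Cardinal.ord_le_ord.2 (le_trans ?_ (Cardinal.cantor l.card).le)
    rw [← Cardinal.ord_le, Cardinal.ord_aleph]
    exact hl
  -- The left summand comes first, so that `ω₁ ⊆ I` and the traces in the definition of fullness
  -- refer exactly to it.
  let f : (Set.Iio (ω₁ : Ordinal.{u}) ⊕ Set (Set.Iio l)) → Set.Iio (ω₁ + o) := Sum.elim
    (fun β => ⟨β, Set.mem_Iio.2 (lt_of_lt_of_le (Set.mem_Iio.1 β.2) le_self_add)⟩)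
    (fun y => ⟨ω₁ + ψ y, Set.mem_Iio.2 ((add_lt_add_iff_left ω₁).2 (ψ y).2)⟩)
  have hf : Function.Bijective f := by
    constructor
    · rintro (β | y) (β' | y') heq
      · have hval := Subtype.ext_iff.1 heq
        exact congrArg Sum.inl (Subtype.ext hval)
      · have : (β : Ordinal) = ω₁ + ψ y' := congrArg Subtype.val heq
        exact ((this ▸ β.2 : ω₁ + (ψ y' : Ordinal) < ω₁).not_ge le_self_add).elim
      · have : ω₁ + ψ y = (β' : Ordinal) := congrArg Subtype.val heq
        exact ((this ▸ β'.2 : ω₁ + (ψ y : Ordinal) < ω₁).not_ge le_self_add).elim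
      · have : ω₁ + (ψ y : Ordinal) = ω₁ + ψ y' := congrArg Subtype.val heq
        exact congrArg Sum.inr (ψ.injective (Subtype.ext (add_left_cancel this)))
    · rintro ⟨ξ, hξ⟩
      rcases lt_or_ge ξ ω₁ with hlt | hge
      · exact ⟨Sum.inl ⟨ξ, hlt⟩, rfl⟩
      · have hsub : ω₁ + (ξ - ω₁) = ξ := Ordinal.add_sub_cancel_of_le hge
        have hlt : ξ - ω₁ < o := by
          rw [← add_lt_add_iff_left ω₁, hsub]
          exact hξ
        refine ⟨Sum.inr (ψ.symm ⟨ξ - ω₁, hlt⟩), Subtype.ext ?_⟩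
        simp [f, hsub]
  refine ⟨ω₁ + o, h2.trans le_add_self, Equiv.ofBijective f hf, ?_⟩
  ext x
  rcases x with β | y
  · exact iff_of_true β.2 ⟨β, rfl⟩
  · simp [omegaOneIn, f]

section Reflecting

variable {l : Ordinal.{u}}

theorem infinite_Iio_omega_one : Infinite (Set.Iio (ω₁ : Ordinal.{u})) := by
  rw [← Cardinal.aleph0_le_mk_iff, Cardinal.mk_Iio_ordinal, Ordinal.card_omega]
  simp [aleph0_le_aleph]

/-- `SR`, for families of subsets of `ω₁ ⊕ 𝒫(l)`. -/
theorem SR.exists_reflecting (hSR : SR.{u}) (hl : ω_ 2 ≤ l)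
    {𝒮 : Set (Set (Set.Iio (ω₁ : Ordinal.{u}) ⊕ Set (Set.Iio l)))}
    (h𝒮 : ∀ h : Finset _ → Set _, (∀ E, (h E).Countable) →
      ∃ M ∈ 𝒮, M.Countable ∧ IsClosedUnder h M) :
    ∃ J : Set (Set.Iio (ω₁ : Ordinal.{u}) ⊕ Set (Set.Iio l)), #J = ℵ₁ ∧ Set.range Sum.inl ⊆ J ∧
      ∀ h : Finset _ → Set _, (∀ E, (h E).Countable) →
        ∃ M ∈ 𝒮, M ⊆ J ∧ M.Countable ∧ IsClosedUnder (fun E => h E ∩ J) M := by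
  have := infinite_Iio_omega_one.{u}
  obtain ⟨l', hl', φ, hφ⟩ := exists_equiv_Iio l hl
  obtain ⟨I, hI, hωI, hIS⟩ := hSR l' hl' _ (isStationaryOmega_preimage φ h𝒮)
  refine ⟨φ ⁻¹' I, ?_, hφ ▸ Set.preimage_mono hωI, exists_of_isStationaryOmega φ hIS⟩
  rw [← hI]
  exact Cardinal.mk_preimage_equiv φ I

/-- `SSR`, for families of subsets of `ω₁ ⊕ 𝒫(l)`. -/
theorem SSR.exists_reflecting (hSSR : SSR.{u}) (hl : ω_ 2 ≤ l)
    {𝒮 : Set (Set (Set.Iio (ω₁ : Ordinal.{u}) ⊕ Set (Set.Iio l)))}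
    (h𝒮 : ∀ h : Finset _ → Set _, (∀ E, (h E).Countable) →
      ∃ M ∈ 𝒮, M.Countable ∧ IsClosedUnder h M)
    (hfull : ∀ M ∈ 𝒮, ∀ M' : Set _, M ⊆ M' → Sum.inl ⁻¹' M = Sum.inl ⁻¹' M' → M' ∈ 𝒮) :
    ∃ J : Set (Set.Iio (ω₁ : Ordinal.{u}) ⊕ Set (Set.Iio l)), #J = ℵ₁ ∧ Set.range Sum.inl ⊆ J ∧
      ∀ h : Finset _ → Set _, (∀ E, (h E).Countable) →
        ∃ M ∈ 𝒮, M ⊆ J ∧ M.Countable ∧ IsClosedUnder (fun E => h E ∩ J) M := by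
  have := infinite_Iio_omega_one.{u}
  obtain ⟨l', hl', φ, hφ⟩ := exists_equiv_Iio l hl
  obtain ⟨I, hI, hωI, hIS⟩ := hSSR l' hl' _ (isStationaryOmega_preimage φ h𝒮) (by
    rintro x ⟨-, hx⟩ y ⟨-, hy⟩ ⟨hxy, htr⟩
    refine ⟨hy, hfull _ hx _ (Set.preimage_mono hxy) ?_⟩
    ext β
    have hβ : φ (Sum.inl β) ∈ omegaOneIn l' := by
      change Sum.inl β ∈ φ ⁻¹' omegaOneIn l'
      rw [hφ]
      exact ⟨β, rfl⟩
    have := Set.ext_iff.1 htr (φ (Sum.inl β))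
    simpa [hβ] using this)
  refine ⟨φ ⁻¹' I, ?_, hφ ▸ Set.preimage_mono hωI, exists_of_isStationaryOmega φ hIS⟩
  rw [← hI]
  exact Cardinal.mk_preimage_equiv φ I

end Reflecting

/-! ### Nodes and branches coded by sets. -/

section CodedTree

/-- The characteristic function of `A`, restricted to `u`. -/
noncomputable def indicatorOn {α : Type v} (A u : Set α) : α →. Bool :=
  open Classical in PFun.res (fun a => decide (a ∈ A)) u

theorem indicatorOn_congr {α : Type v} {A B u : Set α} (h : A ∩ u = B ∩ u) :
    indicatorOn A u = indicatorOn B u := by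
  classical
  refine PFun.ext fun a b => ?_
  rw [indicatorOn, indicatorOn, PFun.mem_res, PFun.mem_res]
  refine and_congr_right fun ha => ?_
  have := Set.ext_iff.1 h a
  simp only [Set.mem_inter_iff, ha, and_true] at this
  simp only [this]

theorem indicatorOn_injOn {α : Type v} {A B u : Set α} (hA : A ⊆ u) (hB : B ⊆ u)
    (h : indicatorOn A u = indicatorOn B u) : A = B := by
  classical
  ext a
  by_cases ha : a ∈ u
  · have h1 : true ∈ indicatorOn A u a ↔ true ∈ indicatorOn B u a := by rw [h]
    simpa [indicatorOn, PFun.mem_res, ha] using h1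
  · exact ⟨fun h' => (ha (hA h')).elim, fun h' => (ha (hB h')).elim⟩

theorem indicatorOn_setOf_true {α : Type v} (f : α →. Bool) :
    indicatorOn {a | true ∈ f a} f.Dom = f := by
  classical
  refine PFun.ext fun a b => ?_
  rw [indicatorOn, PFun.mem_res]
  constructor
  · rintro ⟨ha, hb⟩
    obtain ⟨c, hc⟩ := Part.dom_iff_mem.1 ha
    cases b with
    | true => simpa using hb
    | false =>
      cases c with
      | false => exact hc
      | true =>
        have : ¬ true ∈ f a := by simpa using hb
        exact (this hc).elim
  · intro hb
    refine ⟨Part.dom_iff_mem.2 ⟨b, hb⟩, ?_⟩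
    cases b with
    | true => simpa using hb
    | false =>
      simp only [Set.mem_ofPred_eq, decide_eq_false_iff_not]
      intro h
      exact absurd (Part.mem_unique h hb) (by simp)

theorem indicatorOn_dom {α : Type v} (A u : Set α) : (indicatorOn A u).Dom = u := rfl

variable {l : Ordinal.{u}} {F : Set (Set.Iio l →. Bool)}

theorem aleph_two_eq_succ : (ℵ_ 2 : Cardinal.{v}) = Order.succ ℵ₁ := by
  rw [Cardinal.succ_aleph, one_add_one_eq_two]

theorem mem_smallSubsetsOrd_iff {u : Set (Set.Iio l)} :
    u ∈ smallSubsetsOrd (ℵ_ 2) l ↔ u ∈ smallSets (Set.Iio l) := by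
  simp only [smallSubsetsOrd, smallSubsets, smallSets, Set.mem_ofPred_eq, Set.subset_univ,
    true_and, Cardinal.lift_aleph, Ordinal.lift_ofNat]
  rw [aleph_two_eq_succ, Order.lt_succ_iff]

/-- The `u`-level of `F`, with partial functions coded as subsets of `u`. -/
def codedLevel (F : Set (Set.Iio l →. Bool)) (u : Set (Set.Iio l)) : Set (Set (Set.Iio l)) :=
  {A | A ⊆ u ∧ indicatorOn A u ∈ F}

theorem inter_mem_codedLevel_iff {A u : Set (Set.Iio l)} :
    A ∩ u ∈ codedLevel F u ↔ indicatorOn A u ∈ F := by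
  rw [codedLevel, Set.mem_ofPred_eq, indicatorOn_congr (A := A ∩ u) (B := A) (by simp)]
  exact and_iff_right Set.inter_subset_right

theorem IsThin.mk_codedLevel_le (hF : IsThin (ℵ_ 2) l F) {u : Set (Set.Iio l)}
    (hu : u ∈ smallSets (Set.Iio l)) : #(codedLevel F u) ≤ ℵ₁ := by
  have h1 := hF u (mem_smallSubsetsOrd_iff.2 hu)
  rw [Cardinal.lift_aleph, Ordinal.lift_ofNat, aleph_two_eq_succ, Order.lt_succ_iff] at h1
  refine le_trans ?_ h1
  refine Cardinal.mk_le_of_injective (f := fun A : codedLevel F u =>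
    (⟨indicatorOn A.1 u, A.2.2, indicatorOn_dom _ _⟩ : level F u)) ?_
  intro A B h
  exact Subtype.ext (indicatorOn_injOn A.2.1 B.2.1 (congrArg Subtype.val h))

theorem setOf_true_mem_codedLevel {f : Set.Iio l →. Bool} {u : Set (Set.Iio l)}
    (hf : f ∈ level F u) : {a | true ∈ f a} ∈ codedLevel F u := by
  obtain ⟨hfF, rfl⟩ := hf
  refine ⟨fun a ha => Part.dom_iff_mem.2 ⟨_, ha⟩, ?_⟩
  rwa [indicatorOn_setOf_true]

theorem IsTwoCardinalTree.nonempty_codedLevel (hF : IsTwoCardinalTree (ℵ_ 2) l F)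
    {u : Set (Set.Iio l)} (hu : u ∈ smallSets (Set.Iio l)) : (codedLevel F u).Nonempty := by
  obtain ⟨f, hf⟩ := hF.level_nonempty u (mem_smallSubsetsOrd_iff.2 hu)
  exact ⟨_, setOf_true_mem_codedLevel hf⟩

theorem IsTwoCardinalTree.inter_mem_codedLevel {κ : Cardinal.{u}} (hF : IsTwoCardinalTree κ l F)
    {A u w : Set (Set.Iio l)} (hA : A ∈ codedLevel F u) (hw : w ⊆ u) :
    A ∩ w ∈ codedLevel F w := by
  classical
  rw [inter_mem_codedLevel_iff]
  have := hF.restrict_mem _ hA.2 w hw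
  convert this using 1
  refine PFun.ext fun a b => ?_
  refine (PFun.mem_res _ _ _ _).trans (Iff.trans ?_ (PFun.mem_restrict hw a b).symm)
  refine and_congr_right fun ha => Iff.trans ?_ (PFun.mem_res _ _ _ _).symm
  exact (and_iff_right (hw ha)).symm

/-- `B` codes a cofinal branch through `F`. -/
def IsCodedBranch (F : Set (Set.Iio l →. Bool)) (B : Set (Set.Iio l)) : Prop :=
  ∀ u ∈ smallSets (Set.Iio l), B ∩ u ∈ codedLevel F u

theorem IsCodedBranch.isCofinalBranch {B : Set (Set.Iio l)} (hB : IsCodedBranch F B) :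
    open Classical in IsCofinalBranch (ℵ_ 2) F (fun a => decide (a ∈ B)) := fun u hu =>
  inter_mem_codedLevel_iff.1 (hB u (mem_smallSubsetsOrd_iff.1 hu))

/-- Provides a function defined for all `B`; a set `M` closed under it sees the failure of each of
its non-branches. -/
theorem exists_counterexample (B : Set (Set.Iio l)) : ∃ w, ¬ IsCodedBranch F B →
    w ∈ smallSets (Set.Iio l) ∧ B ∩ w ∉ codedLevel F w := by
  by_cases hB : IsCodedBranch F B
  · exact ⟨∅, fun h => (h hB).elim⟩
  · unfold IsCodedBranch at hB
    push Not at hB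
    obtain ⟨w, hw⟩ := hB
    exact ⟨w, fun _ => hw⟩

/-- An enumeration of all levels of a thin tree in order type `ω₁`. -/
theorem exists_enumeration (hT : IsTwoCardinalTree (ℵ_ 2) l F) (hF : IsThin (ℵ_ 2) l F) :
    ∃ e : Set (Set.Iio l) → Set.Iio (ω₁ : Ordinal.{u}) → Set (Set.Iio l),
      ∀ u ∈ smallSets (Set.Iio l), ∀ A ∈ codedLevel F u, ∃ β, A = e u β := by
  have : ∀ u ∈ smallSets (Set.Iio l), ∃ e : Set.Iio (ω₁ : Ordinal.{u}) → Set (Set.Iio l),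
      ∀ A ∈ codedLevel F u, ∃ β, A = e β := by
    intro u hu
    have hle : #(codedLevel F u) ≤ #(Set.Iio (ω₁ : Ordinal.{u})) := by
      rw [Cardinal.mk_Iio_ordinal, Ordinal.card_omega]
      simpa using hF.mk_codedLevel_le hu
    obtain ⟨g⟩ := hle
    have := (hT.nonempty_codedLevel hu).to_subtype
    refine ⟨fun β => (Function.invFun (fun A => g A) β).1, fun A hA => ⟨g ⟨A, hA⟩, ?_⟩⟩
    exact congrArg Subtype.val (Function.leftInverse_invFun g.injective ⟨A, hA⟩).symm
  choose! e he using this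
  exact ⟨e, he⟩

/-- A guessing set sees a branch agreeing with `T` if it contains the places of all restrictions of
`T` and is closed under a choice `w` of counterexamples to being a branch. -/
theorem IsGuessing.exists_isCodedBranch {κ : Cardinal.{u}} {Ω : Type (u + 1)}
    (hT : IsTwoCardinalTree κ l F) {e : Set (Set.Iio l) → Ω → Set (Set.Iio l)}
    {M : Set (Ω ⊕ Set (Set.Iio l))} (hM : IsGuessing (codedLevel F) e M)
    {w : Set (Set.Iio l) → Set (Set.Iio l)}
    (hw : ∀ B, ¬ IsCodedBranch F B → w B ∈ smallSets (Set.Iio l) ∧ B ∩ w B ∉ codedLevel F (w B))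
    (hwM : ∀ B, Sum.inr B ∈ M → Sum.inr (w B) ∈ M) {V T : Set (Set.Iio l)}
    (hTV : T ∈ codedLevel F V) (hMV : smallSupport M ⊆ V)
    (happ : ∀ u ∈ smallSets (Set.Iio l), Sum.inr u ∈ M → ∃ β, Sum.inl β ∈ M ∧ T ∩ u = e u β) :
    ∃ B, Sum.inr B ∈ M ∧ T ∩ smallSupport M = B ∩ smallSupport M ∧ IsCodedBranch F B := by
  have hsub : ∀ u ∈ smallSets (Set.Iio l), Sum.inr u ∈ M → u ⊆ smallSupport M :=
    fun u hu huM => Set.subset_sUnion_of_mem ⟨hu, huM⟩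
  obtain ⟨B, hBM, hB⟩ := hM (T ∩ smallSupport M) (hT.inter_mem_codedLevel hTV hMV)
    Set.inter_subset_right (fun u hu huM => by
      rw [Set.inter_assoc, Set.inter_eq_right.2 (hsub u hu huM)]
      exact happ u hu huM)
  refine ⟨B, hBM, hB, ?_⟩
  -- If `B` were no branch, its counterexample `w B` would be covered by the support of `M`, where
  -- `B` agrees with the node `T`; but restrictions of `T` stay in the tree.
  by_contra hcon
  obtain ⟨h1, h2⟩ := hw B hcon
  have h3 := hsub _ h1 (hwM B hBM)
  apply h2
  have h4 : B ∩ w B = T ∩ w B := by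
    rw [← Set.inter_eq_right.2 h3, ← Set.inter_assoc, ← Set.inter_assoc, hB]
  rw [h4]
  exact hT.inter_mem_codedLevel hTV (h3.trans hMV)

end CodedTree

/-! ### The two tree properties. -/

section Main

variable {l : Ordinal.{u}} {F : Set (Set.Iio l →. Bool)}

theorem mk_Iio_omega_one : #(Set.Iio (ω₁ : Ordinal.{u})) = ℵ₁ := by
  rw [Cardinal.mk_Iio_ordinal, Ordinal.card_omega, Cardinal.lift_aleph, Ordinal.lift_one]

theorem countable_Iio_of_omega_one (δ : Set.Iio (ω₁ : Ordinal.{u})) : (Set.Iio δ).Countable := by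
  have hδ : (Set.Iio (δ : Ordinal.{u})).Countable := by
    rw [← Cardinal.le_aleph0_iff_set_countable, Cardinal.mk_Iio_ordinal, Cardinal.lift_le_aleph0,
      ← Order.lt_succ_iff, succ_aleph0]
    exact Cardinal.lt_ord.1 (lt_of_lt_of_eq δ.2 (Cardinal.ord_aleph 1).symm)
  exact hδ.preimage_of_injOn (f := Subtype.val) Subtype.val_injective.injOn

theorem smallSupport_mem_smallSets {Ω α : Type v} {J : Set (Ω ⊕ Set α)} (hJ : #J ≤ ℵ₁) :
    smallSupport J ∈ smallSets α := by
  refine sUnion_mem_smallSets (le_trans ?_ hJ) fun u hu => hu.1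
  refine Cardinal.mk_le_of_injective (f := fun u : {u | u ∈ smallSets α ∧ Sum.inr u ∈ J} =>
    (⟨Sum.inr u.1, u.2.2⟩ : J)) ?_
  intro u w h
  exact Subtype.ext (Sum.inr_injective (congrArg Subtype.val h))

theorem smallSupport_mono {Ω α : Type v} {M J : Set (Ω ⊕ Set α)} (h : M ⊆ J) :
    smallSupport M ⊆ smallSupport J :=
  Set.sUnion_subset_sUnion fun _ hu => ⟨hu.1, h hu.2⟩

theorem countable_inr_mem {Ω α : Type v} (E : Finset (Ω ⊕ Set α)) :
    {B : Set α | Sum.inr B ∈ E}.Countable :=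
  (E.finite_toSet.preimage Sum.inr_injective.injOn).countable

/-- The reflected family consists of the supersets of guessing sets with the same trace on `ω₁`,
which makes it full. Any node on the support of the reflection point then leads to a branch. -/
theorem SSR.tp (hSSR : SSR.{u}) (hMA : MACohen) (hl : ω_ 2 ≤ l) : TP (ℵ_ 2) l := by
  classical
  intro F hT hF
  obtain ⟨e, he⟩ := exists_enumeration hT hF
  choose w hw using exists_counterexample (F := F)
  let h₀ : Finset (Set.Iio (ω₁ : Ordinal.{u}) ⊕ Set (Set.Iio l)) →
      Set (Set.Iio (ω₁ : Ordinal.{u}) ⊕ Set (Set.Iio l)) := fun E =>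
    ⋃ B ∈ {B : Set (Set.Iio l) | Sum.inr B ∈ E}, {Sum.inr (w B)}
  have hh₀ : ∀ E, (h₀ E).Countable := fun E =>
    (countable_inr_mem E).biUnion fun B _ => Set.countable_singleton _
  have h₀w : ∀ M, IsClosedUnder h₀ M → ∀ B, Sum.inr B ∈ M → Sum.inr (w B) ∈ M := fun M hM B hB =>
    hM {Sum.inr B} (by simpa using hB) (Set.mem_biUnion (x := B) (by simp) rfl)
  obtain ⟨J, hJ, hωJ, hJS⟩ := hSSR.exists_reflecting hl
    (𝒮 := {y | ∃ M ⊆ y, Sum.inl ⁻¹' M = Sum.inl ⁻¹' y ∧ IsClosedUnder h₀ M ∧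
      IsGuessing (codedLevel F) e M}) (by
      intro h hh
      obtain ⟨M, hMc, hMh, hMg⟩ := exists_isGuessing hMA countable_Iio_of_omega_one
        mk_Iio_omega_one (codedLevel F) (fun W hW => hF.mk_codedLevel_le hW) e
        (fun E => h E ∪ h₀ E) fun E => (hh E).union (hh₀ E)
      exact ⟨M, ⟨M, subset_rfl, rfl, hMh.mono fun E => Set.subset_union_right, hMg⟩, hMc,
        hMh.mono fun E => Set.subset_union_left⟩) (by
      rintro y ⟨M, hMy, htr, hM⟩ y' hyy' htr'
      exact ⟨M, hMy.trans hyy', htr.trans htr', hM⟩)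
  obtain ⟨T, hTV⟩ := hT.nonempty_codedLevel (smallSupport_mem_smallSets hJ.le)
  have hβ : ∀ u ∈ smallSets (Set.Iio l), Sum.inr u ∈ J → ∃ β, T ∩ u = e u β := fun u hu huJ =>
    he u hu _ (hT.inter_mem_codedLevel hTV (Set.subset_sUnion_of_mem ⟨hu, huJ⟩))
  have := infinite_Iio_omega_one.{u}
  choose! β hβ using hβ
  obtain ⟨y, ⟨M, hMy, htr, hMh, hMg⟩, hyJ, -, hy⟩ := hJS
    (fun E => ⋃ u ∈ {u : Set (Set.Iio l) | Sum.inr u ∈ E}, {Sum.inl (β u)}) fun E =>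
      (countable_inr_mem E).biUnion fun _ _ => Set.countable_singleton _
  obtain ⟨B, -, -, hB⟩ := hMg.exists_isCodedBranch hT hw (h₀w M hMh) hTV
    (smallSupport_mono (hMy.trans hyJ)) (fun u hu huM => by
      refine ⟨β u, ?_, hβ u hu (hyJ (hMy huM))⟩
      change β u ∈ Sum.inl ⁻¹' M
      -- Closure puts the index of `T ∩ u` only into `y`; equality of the traces on `ω₁` moves it
      -- into `M`.
      rw [htr]
      refine hy {Sum.inr u} (by simpa using hMy huM) ⟨?_, hωJ ⟨_, rfl⟩⟩
      exact Set.mem_biUnion (x := u) (by simp) rfl)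
  exact ⟨_, hB.isCofinalBranch⟩

/-- With full `SR` the guessing sets themselves reflect, so the guessing `M ⊆ J` can be closed under
set-valued operations too, not just under indices in `ω₁`. This turns agreement of `B` and `f V` on
the support of `M` into agreement on all of `V`. -/
theorem SR.itp (hSR : SR.{u}) (hMA : MACohen) (hl : ω_ 2 ≤ l) : ITP (ℵ_ 2) l := by
  classical
  intro F hT hF f hf
  obtain ⟨e, he⟩ := exists_enumeration hT hF
  choose w hw using exists_counterexample (F := F)
  by_contra hcon
  -- clubs witnessing that no branch is ineffable
  have hC : ∀ B, IsCodedBranch F B → ∃ C, IsClubIn (ℵ_ 2) (Set.univ : Set (Set.Iio l)) C ∧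
      ∀ u ∈ C, u ∈ smallSets (Set.Iio l) ∧ indicatorOn B u ≠ f u := by
    intro B hB
    by_contra hno
    refine hcon ⟨_, hB.isCofinalBranch, fun u hu => hu.1, fun C hC => ?_⟩
    by_contra hemp
    rw [Cardinal.lift_aleph, Ordinal.lift_ofNat] at hC
    refine hno ⟨C, hC, fun u hu => ?_⟩
    have hu' : u ∈ smallSubsetsOrd (ℵ_ 2) l := by
      rw [smallSubsetsOrd, Cardinal.lift_aleph, Ordinal.lift_ofNat]
      exact hC.subset hu
    exact ⟨mem_smallSubsetsOrd_iff.1 hu', fun heq => hemp ⟨u, ⟨hu', heq⟩, hu⟩⟩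
  choose! C hC hCf using hC
  have hc : ∀ B, IsCodedBranch F B → ∀ u ∈ smallSets (Set.Iio l), ∃ c ∈ C B, u ⊆ c := by
    intro B hB u hu
    refine (hC B hB).cofinal u ?_
    have := mem_smallSubsetsOrd_iff.2 hu
    rwa [smallSubsetsOrd, Cardinal.lift_aleph, Ordinal.lift_ofNat] at this
  choose! c hcC hc using hc
  let h₀ : Finset (Set.Iio (ω₁ : Ordinal.{u}) ⊕ Set (Set.Iio l)) →
      Set (Set.Iio (ω₁ : Ordinal.{u}) ⊕ Set (Set.Iio l)) := fun E =>
    insert (Sum.inr ∅) (⋃ B ∈ {B : Set (Set.Iio l) | Sum.inr B ∈ E}, insert (Sum.inr (w B))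
      (⋃ u ∈ {u : Set (Set.Iio l) | Sum.inr u ∈ E}, {Sum.inr (c B u), Sum.inr (B ∪ u)}))
  have hh₀ : ∀ E, (h₀ E).Countable := fun E =>
    Set.Countable.insert _ ((countable_inr_mem E).biUnion fun B _ => Set.Countable.insert _
      ((countable_inr_mem E).biUnion fun u _ => (Set.toFinite _).countable))
  have h₀w : ∀ M, IsClosedUnder h₀ M → ∀ B, Sum.inr B ∈ M → Sum.inr (w B) ∈ M := fun M hM B hB =>
    hM {Sum.inr B} (by simpa using hB)
      (Or.inr (Set.mem_biUnion (x := B) (by simp) (Or.inl rfl)))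
  have h₀c : ∀ M, IsClosedUnder h₀ M → ∀ B, Sum.inr B ∈ M → ∀ u, Sum.inr u ∈ M →
      Sum.inr (c B u) ∈ M ∧ Sum.inr (B ∪ u) ∈ M := by
    intro M hM B hB u hu
    rw [← Set.singleton_subset_iff (a := Sum.inr (B ∪ u)), ← Set.insert_subset_iff]
    refine Set.Subset.trans ?_ (hM {Sum.inr B, Sum.inr u} (by
      rw [Finset.coe_pair]
      exact Set.insert_subset hB (Set.singleton_subset_iff.2 hu)))
    intro x hx
    exact Or.inr (Set.mem_biUnion (x := B) (by simp) (Or.inr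
      (Set.mem_biUnion (x := u) (by simp) hx)))
  obtain ⟨J, hJ, hωJ, hJS⟩ := hSR.exists_reflecting hl
    (𝒮 := {M | IsClosedUnder h₀ M ∧ IsGuessing (codedLevel F) e M}) (by
      intro h hh
      obtain ⟨M, hMc, hMh, hMg⟩ := exists_isGuessing hMA countable_Iio_of_omega_one
        mk_Iio_omega_one (codedLevel F) (fun W hW => hF.mk_codedLevel_le hW) e
        (fun E => h E ∪ h₀ E) fun E => (hh E).union (hh₀ E)
      exact ⟨M, ⟨hMh.mono fun E => Set.subset_union_right, hMg⟩, hMc,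
        hMh.mono fun E => Set.subset_union_left⟩)
  have hJh : IsClosedUnder h₀ J := by
    intro E hE
    -- The constant function `E` yields an `h₀`-closed `M ⊆ J` that contains the given finite set.
    obtain ⟨M, ⟨hMh, -⟩, hMJ, -, hM⟩ := hJS (fun _ => E) fun _ => E.countable_toSet
    have hEM : ↑E ⊆ M := fun x hx => hM ∅ (by simp) ⟨hx, hE hx⟩
    exact (hMh E hEM).trans hMJ
  set V := smallSupport J with hVdef
  have hV : V ∈ smallSets (Set.Iio l) := smallSupport_mem_smallSets hJ.le
  have hfV := hf V (mem_smallSubsetsOrd_iff.2 hV)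
  set T : Set (Set.Iio l) := {a | true ∈ f V a} with hTdef
  have hTV : T ∈ codedLevel F V := setOf_true_mem_codedLevel hfV
  have hβ : ∀ u ∈ smallSets (Set.Iio l), Sum.inr u ∈ J → ∃ β, T ∩ u = e u β := fun u hu huJ =>
    he u hu _ (hT.inter_mem_codedLevel hTV (Set.subset_sUnion_of_mem ⟨hu, huJ⟩))
  have := infinite_Iio_omega_one.{u}
  choose! β hβ using hβ
  -- As `V` is the union of the small sets in `J`, a difference between `B ∩ V` and `T` already
  -- shows on one of them. An `M` closed under this choice cannot contain a `B` that agrees with `T`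
  -- only on the support of `M`.
  have hd : ∀ B, B ∩ V ≠ T → ∃ d ∈ smallSets (Set.Iio l), Sum.inr d ∈ J ∧ T ∩ d ≠ B ∩ d := by
    intro B hB
    by_contra! hall
    refine hB (Set.ext fun a => ⟨?_, fun ha => ?_⟩)
    · rintro ⟨ha, d, ⟨hd, hdJ⟩, had⟩
      have : a ∈ B ∩ d := ⟨ha, had⟩
      rw [← hall d hd hdJ] at this
      exact this.1
    · obtain ⟨d, ⟨hd, hdJ⟩, had⟩ := hTV.1 ha
      have : a ∈ T ∩ d := ⟨ha, had⟩
      rw [hall d hd hdJ] at this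
      exact ⟨this.1, hTV.1 ha⟩
  choose! d hdZ hdJ hd using hd
  obtain ⟨M, ⟨hMh, hMg⟩, hMJ, -, hM⟩ := hJS
    (fun E => ⋃ u ∈ {u : Set (Set.Iio l) | Sum.inr u ∈ E}, {Sum.inl (β u), Sum.inr (d u)}) fun E =>
      (countable_inr_mem E).biUnion fun _ _ => (Set.toFinite _).countable
  obtain ⟨B, hBM, hBT, hB⟩ := hMg.exists_isCodedBranch hT hw (h₀w M hMh) hTV
    (smallSupport_mono hMJ) (fun u hu huM => by
      refine ⟨β u, hM {Sum.inr u} (by simpa using huM) ⟨?_, hωJ ⟨_, rfl⟩⟩, hβ u hu (hMJ huM)⟩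
      exact Set.mem_biUnion (x := u) (by simp) (Or.inl rfl))
  have hBV : B ∩ V = T := by
    by_contra hne
    have hdM : Sum.inr (d B) ∈ M := hM {Sum.inr B} (by simpa using hBM)
      ⟨Set.mem_biUnion (x := B) (by simp) (Or.inr rfl), hdJ B hne⟩
    have hsub : d B ⊆ smallSupport M := Set.subset_sUnion_of_mem ⟨hdZ B hne, hdM⟩
    refine hd B hne ?_
    rw [← Set.inter_eq_right.2 hsub, ← Set.inter_assoc, ← Set.inter_assoc, hBT]
  -- the support of `J` belongs to the club of `B`
  have hBJ := hMJ hBM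
  let 𝒟 : Set (Set (Set.Iio l)) := c B '' {u | u ∈ smallSets (Set.Iio l) ∧ Sum.inr u ∈ J}
  have h𝒟 : ∀ u ∈ 𝒟, u ∈ smallSets (Set.Iio l) ∧ Sum.inr u ∈ J := by
    rintro _ ⟨u, hu, rfl⟩
    exact ⟨(hCf B hB _ (hcC B hB u hu.1)).1, (h₀c J hJh B hBJ u hu.2).1⟩
  have hVC : V ∈ C B := by
    have hVD : V = ⋃₀ 𝒟 := by
      apply Set.Subset.antisymm
      · rintro a ⟨u, hu, hau⟩
        exact ⟨c B u, ⟨u, hu, rfl⟩, hc B hB u hu.1 hau⟩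
      · exact Set.sUnion_subset fun u hu => Set.subset_sUnion_of_mem (h𝒟 u hu)
    rw [hVD]
    refine (hC B hB).sUnion_mem_of_directedOn ?_ ?_ ?_ ?_
    · rintro _ ⟨u, hu, rfl⟩
      exact hcC B hB u hu.1
    · exact ⟨_, ∅, ⟨empty_mem_smallSets, hJh ∅ (by simp) (Or.inl rfl)⟩, rfl⟩
    -- `h₀` includes unions precisely for this: `u ∪ u'` lies in `J`, so its cover from the club is
    -- again in `𝒟`.
    · intro u hu u' hu'
      have h1 := h𝒟 u hu
      have h2 := h𝒟 u' hu'
      have h3 := union_mem_smallSets h1.1 h2.1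
      have h4 := hc B hB _ h3
      exact ⟨c B (u ∪ u'), ⟨_, ⟨h3, (h₀c J hJh u h1.2 u' h2.2).2⟩, rfl⟩,
        Set.subset_union_left.trans h4, Set.subset_union_right.trans h4⟩
    · refine le_trans ?_ hJ.le
      refine Cardinal.mk_le_of_injective (f := fun u : 𝒟 => (⟨Sum.inr u.1, (h𝒟 u.1 u.2).2⟩ : J)) ?_
      intro u u' h
      exact Subtype.ext (Sum.inr_injective (congrArg Subtype.val h))
  refine (hCf B hB V hVC).2 ?_
  rw [indicatorOn_congr (B := T) (by rw [hBV, Set.inter_eq_left.2 hTV.1])]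
  conv_lhs => rw [← hfV.2]
  exact indicatorOn_setOf_true (f V)

end Main

theorem theorem3p1 :
    (SR.{u} → MACohen → SuperTreeProperty.{u} (ℵ_ 2)) ∧
    (SSR.{u} → MACohen → StrongTreeProperty.{u} (ℵ_ 2)) := by
  constructor
  · intro hSR hMA l hl
    rw [Cardinal.ord_aleph] at hl
    exact hSR.itp hMA hl
  · intro hSSR hMA l hl
    rw [Cardinal.ord_aleph] at hl
    exact hSSR.tp hMA hl
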